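/- Let $\Bbbk$ be a field of characteristic zero, $A$ an associative unital $\Bbbk$-algebra, and $\otimes=\otimes_{\Bbbk}$. For $d=d'\otimes d''\in A\otimes A$ (sums omitted) the outer bimodule structure on $A\otimes A$ is $b\,d\,c=bd'\otimes d''c$, and $d^\circ=d''\otimes d'$. Let $(e_s)_{s\in I}$ be a finite complete family of orthogonal idempotents of $A$ ($e_se_t=\delta_{st}e_s$, $\sum_s e_s=1$), let $B$ be their linear span, and fix two distinct elements of $I$, denoted $1$ and $2$. **Definitions.** A $B$-linear *double bracket* on $A$ is a $\Bbbk$-bilinear map $\{\!\{-,-\}\!\}:A\times A\to A\otimes A$ that vanishes as soon as one argument lies in $B$ and satisfies $\{\!\{a,b\}\!\}=-\{\!\{b,a\}\!\}^\circ$ and $\{\!\{a,bc\}\!\}=\{\!\{a,b\}\!\}c+b\{\!\{a,c\}\!\}$. Put $\tau(a_1\otimes a_2\otimes a_3)=a_3\otimes a_1\otimes a_2$ and $$\{\!\{a,b,c\}\!\}=\{\!\{a,\{\!\{b,c\}\!\}'\}\!\}\otimes\{\!\{b,c\}\!\}''+\tau\big(\{\!\{b,\{\!\{c,a\}\!\}'\}\!\}\otimes\{\!\{c,a\}\!\}''\big)+\tau^2\big(\{\!\{c,\{\!\{a,b\}\!\}'\}\!\}\otimes\{\!\{a,b\}\!\}''\big).$$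 The double bracket is *quasi-Poisson* if for all $a,b,c\in A$ $$\begin{aligned}\{\!\{a,b,c\}\!\}=\tfrac14\sum_{s\in I}\big(&ce_sa\otimes e_sb\otimes e_s-ce_sa\otimes e_s\otimes be_s-ce_s\otimes ae_sb\otimes e_s+ce_s\otimes ae_s\otimes be_s\\&-e_sa\otimes e_sb\otimes e_sc+e_sa\otimes e_s\otimes be_sc+e_s\otimes ae_sb\otimes e_sc-e_s\otimes ae_s\otimes be_sc\big).\end{aligned}$$ $(A,\{\!\{-,-\}\!\},\Phi)$ is a *quasi-Hamiltonian algebra* over $B$ if $\{\!\{-,-\}\!\}$ is a $B$-linear quasi-Poisson double bracket and $\Phi=\sum_s\Phi_s$, with $\Phi_s\in e_sAe_s$, is a *multiplicative moment map*, that is, an invertible element such that for all $s\in I$, $a\in A$ $$\{\!\{\Phi_s,a\}\!\}=\tfrac12\big(ae_s\otimes\Phi_s-e_s\otimes\Phi_sa+a\Phi_s\otimes e_s-\Phi_s\otimes e_sa\big).$$ **Fusion.** Let $\mu=1-e_1-e_2$, let $\mathrm{Mat}_2(\Bbbk)$ have matrix units $e_{11}=e_1,\,e_{12},\,e_{21},\,e_{22}=e_2$,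 and set $\bar A=A*_{\Bbbk e_1\oplus\Bbbk e_2\oplus\Bbbk\mu}(\mathrm{Mat}_2(\Bbbk)\oplus\Bbbk\mu)$ (amalgamated free product), $\epsilon=1-e_2$. The fusion algebra is $A^f=\epsilon\bar A\epsilon$, with unit $\epsilon$ and idempotents $e_s$, $s\ne2$, spanning $B^f$. Put $\mathrm{Tr}(a)=\epsilon a\epsilon+\epsilon e_{12}ae_{21}\epsilon\in A^f$ for $a\in A$. A derivation $\delta:A\to A\otimes A$ (for the outer bimodule structure) vanishing on $B$ extends uniquely to a derivation $\bar A\to\bar A\otimes\bar A$ vanishing on $\mathrm{Mat}_2(\Bbbk)\oplus\Bbbk\mu$, again denoted $\delta$, and gives $\mathrm{Tr}(\delta):A^f\to A^f\otimes A^f$, $\mathrm{Tr}(\delta)(a)=\delta(a)'\epsilon\otimes\epsilon\delta(a)''+\delta(a)'e_{21}\epsilon\otimes\epsilon e_{12}\delta(a)''$. Let $E_s(a)=ae_s\otimes e_s-e_s\otimes e_sa$. A $B$-linear double bracket on $A$ extends uniquely to a double bracket on $\bar A$ that vanishes as soon as one argument lies in $\mathrm{Mat}_2(\Bbbk)\oplus\Bbbk\mu$;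 its restriction to $A^f$, followed by $x\otimes y\mapsto\epsilon x\epsilon\otimes\epsilon y\epsilon$, is the induced bracket $\{\!\{-,-\}\!\}_{ind}$ on $A^f$. Finally set $\{\!\{-,-\}\!\}^f=\{\!\{-,-\}\!\}_{ind}+\{\!\{-,-\}\!\}_{fus}$ with $$\{\!\{b,c\}\!\}_{fus}=-\tfrac12\big(\delta_2(c)'\delta_1(b)''\otimes\delta_1(b)'\delta_2(c)''-\delta_1(c)'\delta_2(b)''\otimes\delta_2(b)'\delta_1(c)''\big),\qquad\delta_i=\mathrm{Tr}(E_i).$$ **Theorem.** If $(A,\{\!\{-,-\}\!\},\Phi)$ is a quasi-Hamiltonian algebra over $B$, then $(A^f,\{\!\{-,-\}\!\}^f,\Phi^f)$ is a quasi-Hamiltonian algebra over $B^f$, where $$\Phi^f=e_1\mathrm{Tr}(\Phi_1)\mathrm{Tr}(\Phi_2)e_1+\sum_{s\neq1,2}e_s\mathrm{Tr}(\Phi_s)e_s.$$ Moreover, $A^f$ is a finitely generated algebra if $A$ is. (The double bracket is not assumed to be differential.) -/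

import Mathlib

open scoped TensorProduct

namespace DoubleBracket

noncomputable section

/-! ### Double derivations, double brackets, quasi-Poisson and quasi-Hamiltonian algebras

The algebra structure of `A ⊗ A` is used to write the two bimodule structures: the outer one is
`b · d · c = (b ⊗ 1) * d * (1 ⊗ c)`, i.e. `b d' ⊗ d'' c`, and the inner one is
`b ∗ d ∗ c = (1 ⊗ b) * d * (c ⊗ 1)`, i.e. `d' c ⊗ b d''`. -/

section Basic

variable {k : Type*} [Field k] {A : Type*} [Ring A] [Algebra k A]

/-- A `B`-linear double derivation: a derivation `A → A ⊗ A` for the outer bimodule structure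
that vanishes on `B`. -/
structure IsDoubleDerivation (B : Subalgebra k A) (δ : A →ₗ[k] A ⊗[k] A) : Prop where
  leibniz : ∀ a b : A, δ (a * b) = (a ⊗ₜ[k] 1) * δ b + δ a * (1 ⊗ₜ[k] b)
  vanish : ∀ b ∈ B, δ b = 0

/-- A `B`-linear double bracket on `A`. -/
structure IsDoubleBracket (B : Subalgebra k A) (br : A →ₗ[k] A →ₗ[k] A ⊗[k] A) : Prop where
  antisymm : ∀ a b : A, br a b = -TensorProduct.comm k A A (br b a)
  leibniz : ∀ a b c : A, br a (b * c) = br a b * (1 ⊗ₜ[k] c) + (b ⊗ₜ[k] 1) * br a c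
  vanish_left : ∀ b ∈ B, ∀ a : A, br b a = 0
  vanish_right : ∀ b ∈ B, ∀ a : A, br a b = 0

variable (k A) in
/-- `a₁ ⊗ a₂ ⊗ a₃ ↦ a₃ ⊗ a₁ ⊗ a₂`. -/
def tau : (A ⊗[k] A) ⊗[k] A →ₗ[k] (A ⊗[k] A) ⊗[k] A :=
  (TensorProduct.assoc k A A A).symm.toLinearMap ∘ₗ
    (TensorProduct.comm k (A ⊗[k] A) A).toLinearMap

/-- `⦃a, d'⦄ ⊗ d''` for `d = d' ⊗ d''`. -/
def brLeft (br : A →ₗ[k] A →ₗ[k] A ⊗[k] A) (a : A) : A ⊗[k] A →ₗ[k] (A ⊗[k] A) ⊗[k] A :=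
  LinearMap.rTensor A (br a)

/-- The triple bracket associated to a double bracket. -/
def tripleBracket (br : A →ₗ[k] A →ₗ[k] A ⊗[k] A) (a b c : A) : (A ⊗[k] A) ⊗[k] A :=
  brLeft br a (br b c) + tau k A (brLeft br b (br c a)) + tau k A (tau k A (brLeft br c (br a b)))

/-- The subalgebra `B = ⊕ k e_s` of `A`, for a complete family of orthogonal idempotents. -/
def idemSubalgebra (k : Type*) [Field k] {A : Type*} [Ring A] [Algebra k A] {I : Type*}
    (e : I → A) : Subalgebra k A :=
  Algebra.adjoin k (Set.range e)

/-- The quasi-Poisson condition on the triple bracket. -/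
def IsQuasiPoisson {I : Type*} [Fintype I] (e : I → A) (br : A →ₗ[k] A →ₗ[k] A ⊗[k] A) : Prop :=
  ∀ a b c : A, tripleBracket br a b c = (1 / 4 : k) • ∑ s, (
      (c * e s * a) ⊗ₜ[k] (e s * b) ⊗ₜ[k] (e s)
    - (c * e s * a) ⊗ₜ[k] (e s) ⊗ₜ[k] (b * e s)
    - (c * e s) ⊗ₜ[k] (a * e s * b) ⊗ₜ[k] (e s)
    + (c * e s) ⊗ₜ[k] (a * e s) ⊗ₜ[k] (b * e s)
    - (e s * a) ⊗ₜ[k] (e s * b) ⊗ₜ[k] (e s * c)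
    + (e s * a) ⊗ₜ[k] (e s) ⊗ₜ[k] (b * e s * c)
    + (e s) ⊗ₜ[k] (a * e s * b) ⊗ₜ[k] (e s * c)
    - (e s) ⊗ₜ[k] (a * e s) ⊗ₜ[k] (b * e s * c))

/-- `Φ` is a multiplicative moment map: an invertible element of `⊕ e_s A e_s` whose components
`Φ_s = e_s Φ e_s` satisfy the moment map identity. -/
structure IsMomentMap {I : Type*} [Fintype I] (e : I → A) (br : A →ₗ[k] A →ₗ[k] A ⊗[k] A)
    (Φ : A) : Prop where
  isUnit : IsUnit Φ
  diagonal : Φ = ∑ s, e s * Φ * e s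
  moment : ∀ (s : I) (a : A), br (e s * Φ * e s) a = (1 / 2 : k) • (
      (a * e s) ⊗ₜ[k] (e s * Φ * e s)
    - (e s) ⊗ₜ[k] (e s * Φ * e s * a)
    + (a * (e s * Φ * e s)) ⊗ₜ[k] (e s)
    - (e s * Φ * e s) ⊗ₜ[k] (e s * a))

/-- `(A, br)` is a double quasi-Poisson algebra over `B = ⊕ k e_s`. -/
structure IsDoubleQuasiPoisson {I : Type*} [Fintype I] (e : I → A)
    (br : A →ₗ[k] A →ₗ[k] A ⊗[k] A) : Prop where
  idem : CompleteOrthogonalIdempotents e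
  bracket : IsDoubleBracket (idemSubalgebra k e) br
  quasiPoisson : IsQuasiPoisson e br

/-- `(A, br, Φ)` is a quasi-Hamiltonian algebra over `B = ⊕ k e_s`. -/
structure IsQuasiHamiltonian {I : Type*} [Fintype I] (e : I → A)
    (br : A →ₗ[k] A →ₗ[k] A ⊗[k] A) (Φ : A) : Prop extends IsDoubleQuasiPoisson e br where
  momentMap : IsMomentMap e br Φ

/-- The gauge element `a ↦ a x ⊗ x - x ⊗ x a` of an idempotent `x`. -/
def gauge (k : Type*) [Field k] {A : Type*} [Ring A] [Algebra k A] (x : A) : A →ₗ[k] A ⊗[k] A :=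
  (TensorProduct.mk k A A).flip x ∘ₗ LinearMap.mulRight k x
    - TensorProduct.mk k A A x ∘ₗ LinearMap.mulLeft k x

theorem gauge_apply (x a : A) : gauge k x a = (a * x) ⊗ₜ[k] x - x ⊗ₜ[k] (x * a) := rfl

variable (k A) in
/-- `(d, f) ↦ f' d'' ⊗ d' f''`. -/
def contract : A ⊗[k] A →ₗ[k] A ⊗[k] A →ₗ[k] A ⊗[k] A :=
  TensorProduct.map₂ (LinearMap.mul k A).flip (LinearMap.mul k A) ∘ₗ
    (TensorProduct.comm k A A).toLinearMap

theorem contract_tmul (x y z w : A) :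
    contract k A (x ⊗ₜ[k] y) (z ⊗ₜ[k] w) = (z * y) ⊗ₜ[k] (x * w) := by
  simp [contract]

/-- The double bracket defined by the bivector `δ₁ δ₂`:
`⦃b, c⦄ = δ₂(c)' δ₁(b)'' ⊗ δ₁(b)' δ₂(c)'' - δ₁(c)' δ₂(b)'' ⊗ δ₂(b)' δ₁(c)''`. -/
def bivectorBracket (δ₁ δ₂ : A →ₗ[k] A ⊗[k] A) : A →ₗ[k] A →ₗ[k] A ⊗[k] A :=
  (contract k A).compl₁₂ δ₁ δ₂ - (contract k A).compl₁₂ δ₂ δ₁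

theorem IsDoubleBracket.leibniz_left {B : Subalgebra k A} {br : A →ₗ[k] A →ₗ[k] A ⊗[k] A}
    (h : IsDoubleBracket B br) (a b c : A) :
    br (a * b) c = (1 ⊗ₜ[k] a) * br b c + br a c * (b ⊗ₜ[k] 1) := by
  have key : ∀ u v : A ⊗[k] A, TensorProduct.comm k A A (u * v) =
      TensorProduct.comm k A A u * TensorProduct.comm k A A v := fun u v =>
    map_mul (Algebra.TensorProduct.comm k A A) u v
  rw [h.antisymm (a * b) c, h.leibniz, h.antisymm b c, h.antisymm a c, map_add, key, key]
  simp [add_comm]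

theorem gauge_isDoubleDerivation {I : Type*} [Fintype I] {e : I → A}
    (he : CompleteOrthogonalIdempotents e) (s : I) :
    IsDoubleDerivation (idemSubalgebra k e) (gauge k (e s)) := by
  have hl : ∀ a b : A, gauge k (e s) (a * b) =
      (a ⊗ₜ[k] 1) * gauge k (e s) b + gauge k (e s) a * (1 ⊗ₜ[k] b) := by
    intro a b
    simp [gauge_apply, mul_sub, sub_mul, mul_assoc]
  refine ⟨hl, fun b hb => ?_⟩
  induction hb using Algebra.adjoin_induction with
  | mem x hx =>
    obtain ⟨t, rfl⟩ := hx
    by_cases hst : t = s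
    · subst hst; simp [gauge_apply, (he.idem t).eq]
    · simp [gauge_apply, he.ortho hst, he.ortho (Ne.symm hst)]
  | algebraMap r =>
    simp [gauge_apply, Algebra.algebraMap_eq_smul_one]
  | add x y _ _ hx hy => rw [map_add, hx, hy, add_zero]
  | mul x y _ _ hx hy => rw [hl, hx, hy]; simp

end Basic

/-! ### Amalgamated free product of algebras -/

section Amalgam

variable {k : Type*} [Field k] {C A A' : Type*} [Ring C] [Algebra k C] [Ring A] [Algebra k A]
  [Ring A'] [Algebra k A']

/-- The relations that define the free product of `A` and `A'` over `C`. -/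
inductive AmalgRel (j : C →ₐ[k] A) (j' : C →ₐ[k] A') :
    TensorAlgebra k (A × A') → TensorAlgebra k (A × A') → Prop
  | left_mul (a b : A) : AmalgRel j j' (TensorAlgebra.ι k (a * b, 0))
      (TensorAlgebra.ι k (a, 0) * TensorAlgebra.ι k (b, 0))
  | right_mul (a b : A') : AmalgRel j j' (TensorAlgebra.ι k (0, a * b))
      (TensorAlgebra.ι k (0, a) * TensorAlgebra.ι k (0, b))
  | left_one : AmalgRel j j' (TensorAlgebra.ι k (1, 0)) 1
  | right_one : AmalgRel j j' (TensorAlgebra.ι k (0, 1)) 1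
  | amalg (c : C) : AmalgRel j j' (TensorAlgebra.ι k (j c, 0)) (TensorAlgebra.ι k (0, j' c))

/-- The free product `A ∗_C A'`, a quotient of the tensor algebra of `A ⊕ A'`. -/
def Amalgam (j : C →ₐ[k] A) (j' : C →ₐ[k] A') : Type _ := RingQuot (AmalgRel j j')

variable (j : C →ₐ[k] A) (j' : C →ₐ[k] A')

instance : Ring (Amalgam j j') := inferInstanceAs (Ring (RingQuot (AmalgRel j j')))

instance : Algebra k (Amalgam j j') := inferInstanceAs (Algebra k (RingQuot (AmalgRel j j')))

namespace Amalgam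

/-- The quotient map. -/
def mk : TensorAlgebra k (A × A') →ₐ[k] Amalgam j j' := RingQuot.mkAlgHom k (AmalgRel j j')

variable {j j'} in
theorem mk_rel {x y : TensorAlgebra k (A × A')} (h : AmalgRel j j' x y) : mk j j' x = mk j j' y :=
  RingQuot.mkAlgHom_rel k h

/-- The canonical map `A → A ∗_C A'`. -/
def inl : A →ₐ[k] Amalgam j j' :=
  AlgHom.ofLinearMap ((mk j j').toLinearMap ∘ₗ TensorAlgebra.ι k ∘ₗ LinearMap.inl k A A')
    (by simpa using mk_rel (AmalgRel.left_one (j := j) (j' := j')))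
    (fun a b => by simpa using mk_rel (AmalgRel.left_mul (j := j) (j' := j') a b))

/-- The canonical map `A' → A ∗_C A'`. -/
def inr : A' →ₐ[k] Amalgam j j' :=
  AlgHom.ofLinearMap ((mk j j').toLinearMap ∘ₗ TensorAlgebra.ι k ∘ₗ LinearMap.inr k A A')
    (by simpa using mk_rel (AmalgRel.right_one (j := j) (j' := j')))
    (fun a b => by simpa using mk_rel (AmalgRel.right_mul (j := j) (j' := j') a b))

theorem inl_apply (a : A) : inl j j' a = mk j j' (TensorAlgebra.ι k (a, 0)) := rfl

theorem inr_apply (a : A') : inr j j' a = mk j j' (TensorAlgebra.ι k (0, a)) := rfl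

theorem inl_eq_inr (c : C) : inl j j' (j c) = inr j j' (j' c) := mk_rel (AmalgRel.amalg c)

variable {j j'} in
/-- Induction over sums and products of elements of `A` and `A'`. -/
theorem induction {P : Amalgam j j' → Prop} (hl : ∀ a, P (inl j j' a)) (hr : ∀ a, P (inr j j' a))
    (hadd : ∀ x y, P x → P y → P (x + y)) (hmul : ∀ x y, P x → P y → P (x * y))
    (x : Amalgam j j') : P x := by
  obtain ⟨x, rfl⟩ := RingQuot.mkAlgHom_surjective k (AmalgRel j j') x
  change P (mk j j' x)
  induction x using TensorAlgebra.induction with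
  | algebraMap r => simpa using hl (algebraMap k A r)
  | ι m =>
    have : mk j j' (TensorAlgebra.ι k m) = inl j j' m.1 + inr j j' m.2 := by
      rw [inl_apply, inr_apply, ← map_add, ← map_add]; simp
    rw [this]
    exact hadd _ _ (hl _) (hr _)
  | mul x y hx hy => rw [map_mul]; exact hmul _ _ hx hy
  | add x y hx hy => rw [map_add]; exact hadd _ _ hx hy

variable {S : Type*} [Ring S] [Algebra k S]

variable {j j'} in
/-- The universal property of `A ∗_C A'`. -/
def lift (f : A →ₐ[k] S) (g : A' →ₐ[k] S) (h : ∀ c, f (j c) = g (j' c)) : Amalgam j j' →ₐ[k] S :=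
  RingQuot.liftAlgHom k ⟨TensorAlgebra.lift k (f.toLinearMap.coprod g.toLinearMap), by
    rintro _ _ (⟨a, b⟩ | ⟨a, b⟩ | _ | _ | c) <;> simp [h]⟩

variable {j j'} in
theorem lift_mk (f : A →ₐ[k] S) (g : A' →ₐ[k] S) (h : ∀ c, f (j c) = g (j' c))
    (x : TensorAlgebra k (A × A')) :
    lift f g h (mk j j' x) = TensorAlgebra.lift k (f.toLinearMap.coprod g.toLinearMap) x :=
  RingQuot.liftAlgHom_mkAlgHom_apply ..

variable {j j'} in
theorem lift_inl (f : A →ₐ[k] S) (g : A' →ₐ[k] S) (h : ∀ c, f (j c) = g (j' c)) (a : A) :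
    lift f g h (inl j j' a) = f a := by
  rw [inl_apply, lift_mk]; simp

variable {j j'} in
theorem lift_inr (f : A →ₐ[k] S) (g : A' →ₐ[k] S) (h : ∀ c, f (j c) = g (j' c)) (a : A') :
    lift f g h (inr j j' a) = g a := by
  rw [inr_apply, lift_mk]; simp

end Amalgam

/-- The algebra map `a ↦ (l a, d a; 0, r a)` attached to an `(l, r)`-derivation `d`. -/
def triHom {R S : Type*} [Ring R] [Algebra k R] [Ring S] [Algebra k S] (l r : R →ₐ[k] S)
    (d : R →ₗ[k] S) (hd : ∀ a b, d (a * b) = l a * d b + d a * r b) :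
    R →ₐ[k] Matrix (Fin 2) (Fin 2) S :=
  AlgHom.ofLinearMap
    { toFun := fun a => !![l a, d a; 0, r a]
      map_add' := fun a b => by ext i j; fin_cases i <;> fin_cases j <;> simp
      map_smul' := fun c a => by ext i j; fin_cases i <;> fin_cases j <;> simp }
    (by
      have h1 : d 1 = 0 := by simpa using hd 1 1
      ext i j; fin_cases i <;> fin_cases j <;> simp [h1])
    (fun a b => by
      ext i j; fin_cases i <;> fin_cases j <;> simp [hd, Matrix.mul_apply])

theorem triHom_apply {R S : Type*} [Ring R] [Algebra k R] [Ring S] [Algebra k S] (l r : R →ₐ[k] S)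
    (d : R →ₗ[k] S) (hd : ∀ a b, d (a * b) = l a * d b + d a * r b) (a : R) :
    triHom l r d hd a = !![l a, d a; 0, r a] := rfl

namespace Amalgam

variable {S : Type*} [Ring S] [Algebra k S]

section

variable {j j'}
variable (l r : Amalgam j j' →ₐ[k] S) (d : A →ₗ[k] S)
  (hd : ∀ a b, d (a * b) = l (inl j j' a) * d b + d a * r (inl j j' b)) (hj : ∀ c, d (j c) = 0)

/-- The algebra map on `A ∗_C A'` that is `(l, d; 0, r)` on `A` and `(l, 0; 0, r)` on `A'`. -/
def extendHom : Amalgam j j' →ₐ[k] Matrix (Fin 2) (Fin 2) S :=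
  lift (triHom (l.comp (inl j j')) (r.comp (inl j j')) d (fun a b => by simpa using hd a b))
    (triHom (l.comp (inr j j')) (r.comp (inr j j')) 0 (by simp))
    (fun c => by rw [triHom_apply, triHom_apply]; simp [hj, inl_eq_inr])

/-- The extension to `A ∗_C A'`, by zero on `A'`, of a derivation `d` on `A` that vanishes on `C`;
the bimodule structure of the target is given by the algebra maps `l` and `r`. -/
def extend : Amalgam j j' →ₗ[k] S :=
  Matrix.entryLinearMap k S (0 : Fin 2) (1 : Fin 2) ∘ₗ (extendHom l r d hd hj).toLinearMap

theorem extend_apply (x : Amalgam j j') : extend l r d hd hj x = extendHom l r d hd hj x 0 1 := rfl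

theorem extend_inl (a : A) : extend l r d hd hj (inl j j' a) = d a := by
  rw [extend_apply, extendHom, lift_inl, triHom_apply]; simp

theorem extend_inr (a : A') : extend l r d hd hj (inr j j' a) = 0 := by
  rw [extend_apply, extendHom, lift_inr, triHom_apply]; simp

theorem extendHom_apply (x : Amalgam j j') :
    extendHom l r d hd hj x = !![l x, extend l r d hd hj x; 0, r x] := by
  induction x using Amalgam.induction with
  | hl a => rw [extend_inl, extendHom, lift_inl, triHom_apply]; simp
  | hr a => rw [extend_inr, extendHom, lift_inr, triHom_apply]; simp
  | hadd x y hx hy =>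
    rw [map_add, hx, hy]; ext i j; fin_cases i <;> fin_cases j <;> simp
  | hmul x y hx hy =>
    rw [extend_apply, map_mul, hx, hy]
    ext i j; fin_cases i <;> fin_cases j <;> simp [Matrix.mul_apply]

theorem extend_mul (x y : Amalgam j j') :
    extend l r d hd hj (x * y) = l x * extend l r d hd hj y + extend l r d hd hj x * r y := by
  rw [extend_apply l r d hd hj (x * y), map_mul, extendHom_apply, extendHom_apply]
  simp [Matrix.mul_apply]

/-- Two derivations on `A ∗_C A'` that agree on `A` and on `A'` are equal. -/
theorem derivation_ext {D D' : Amalgam j j' →ₗ[k] S}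
    (hD : ∀ x y, D (x * y) = l x * D y + D x * r y)
    (hD' : ∀ x y, D' (x * y) = l x * D' y + D' x * r y)
    (h1 : ∀ a, D (inl j j' a) = D' (inl j j' a)) (h2 : ∀ a, D (inr j j' a) = D' (inr j j' a)) :
    D = D' := by
  ext x
  induction x using Amalgam.induction with
  | hl a => exact h1 a
  | hr a => exact h2 a
  | hadd x y hx hy => rw [map_add, map_add, hx, hy]
  | hmul x y hx hy => rw [hD, hD', hx, hy]

end

section Induced

variable {j j'}

variable (j j') in
/-- `i ⊗ i` for the canonical map `i : A → A ∗_C A'`. -/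
def inlTensor : A ⊗[k] A →ₐ[k] Amalgam j j' ⊗[k] Amalgam j j' :=
  Algebra.TensorProduct.map (inl j j') (inl j j')

theorem inlTensor_tmul (a b : A) :
    inlTensor j j' (a ⊗ₜ[k] b) = inl j j' a ⊗ₜ[k] inl j j' b := rfl

/-- The image in `A ∗_C A'` of a double derivation on `A` that vanishes on `B ⊇ j(C)`: it extends
the given one and vanishes on `A'`. -/
def pushDer {B : Subalgebra k A} (hB : ∀ c, j c ∈ B) {δ : A →ₗ[k] A ⊗[k] A}
    (hδ : IsDoubleDerivation B δ) : Amalgam j j' →ₗ[k] Amalgam j j' ⊗[k] Amalgam j j' :=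
  extend Algebra.TensorProduct.includeLeft Algebra.TensorProduct.includeRight
    ((inlTensor j j').toLinearMap ∘ₗ δ)
    (fun a b => by simp [hδ.leibniz, inlTensor_tmul])
    (fun c => by simp [hδ.vanish _ (hB c)])

section

variable {B : Subalgebra k A} (hB : ∀ c, j c ∈ B) {br : A →ₗ[k] A →ₗ[k] A ⊗[k] A}
  (hbr : IsDoubleBracket B br)

/-- The extension of `⦃a, -⦄` to `A ∗_C A'`, for `a` in `A`. -/
def pushRight (a : A) : Amalgam j j' →ₗ[k] Amalgam j j' ⊗[k] Amalgam j j' :=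
  extend Algebra.TensorProduct.includeLeft Algebra.TensorProduct.includeRight
    ((inlTensor j j').toLinearMap ∘ₗ br a)
    (fun b c => by simp [hbr.leibniz, inlTensor_tmul, add_comm])
    (fun c => by simp [hbr.vanish_right _ (hB c)])

theorem pushRight_mul (a : A) (x y : Amalgam j j') :
    pushRight hB hbr a (x * y) =
      (x ⊗ₜ[k] 1) * pushRight hB hbr a y + pushRight hB hbr a x * (1 ⊗ₜ[k] y) :=
  extend_mul _ _ _ _ _ x y

theorem pushRight_inl (a b : A) :
    pushRight hB hbr a (inl j j' b) = inlTensor j j' (br a b) :=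
  extend_inl _ _ _ _ _ b

theorem pushRight_inr (a : A) (b : A') :
    pushRight hB hbr a (inr j j' b) = 0 :=
  extend_inr _ _ _ _ _ b

/-- `pushRight` as a linear map in both arguments. -/
def pushRightₗ : A →ₗ[k] Amalgam j j' →ₗ[k] Amalgam j j' ⊗[k] Amalgam j j' where
  toFun := pushRight hB hbr
  map_add' a b := by
    refine derivation_ext Algebra.TensorProduct.includeLeft Algebra.TensorProduct.includeRight
      (pushRight_mul hB hbr _) (fun x y => ?_) (fun c => ?_) (fun c => ?_)
    · simp only [LinearMap.add_apply, pushRight_mul, mul_add, add_mul,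
        Algebra.TensorProduct.includeLeft_apply, Algebra.TensorProduct.includeRight_apply]
      abel
    · simp [pushRight_inl]
    · simp [pushRight_inr]
  map_smul' t a := by
    refine derivation_ext Algebra.TensorProduct.includeLeft Algebra.TensorProduct.includeRight
      (pushRight_mul hB hbr _) (fun x y => ?_) (fun c => ?_) (fun c => ?_)
    · simp [pushRight_mul]
    · simp [pushRight_inl]
    · simp [pushRight_inr]

theorem pushRight_mul_left (a b : A) (x : Amalgam j j') :
    pushRight hB hbr (a * b) x = (1 ⊗ₜ[k] inl j j' a) * pushRight hB hbr b x
      + pushRight hB hbr a x * (inl j j' b ⊗ₜ[k] 1) := by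
  have h1 : ∀ u v : Amalgam j j', ((1 : Amalgam j j') ⊗ₜ[k] u) * (v ⊗ₜ[k] (1 : Amalgam j j')) =
      (v ⊗ₜ[k] 1) * (1 ⊗ₜ[k] u) := fun u v => by simp
  induction x using Amalgam.induction with
  | hl c => simp [pushRight_inl, hbr.leibniz_left, inlTensor_tmul]
  | hr c => simp [pushRight_inr]
  | hadd x y hx hy => simp only [map_add, hx, hy, mul_add, add_mul]; abel
  | hmul x y hx hy =>
    simp only [pushRight_mul, hx, hy, mul_add, add_mul]
    rw [← mul_assoc (1 ⊗ₜ[k] inl j j' a) (x ⊗ₜ[k] 1), h1, mul_assoc (pushRight hB hbr a x) _ _,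
      ← h1 y]
    simp only [mul_assoc]
    abel

/-- The extension of `⦃-, x⦄` to `A ∗_C A'`, for `x` in `A ∗_C A'`. -/
def pushLeft (x : Amalgam j j') : Amalgam j j' →ₗ[k] Amalgam j j' ⊗[k] Amalgam j j' :=
  extend Algebra.TensorProduct.includeRight Algebra.TensorProduct.includeLeft
    ((pushRightₗ hB hbr).flip x)
    (fun a b => pushRight_mul_left hB hbr a b x)
    (fun c => by
      change pushRight hB hbr (j c) x = 0
      have h0 : br (j c) = 0 := LinearMap.ext fun a => hbr.vanish_left _ (hB c) a
      induction x using Amalgam.induction with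
      | hl c => simp [pushRight_inl, h0]
      | hr c => simp [pushRight_inr]
      | hadd x y hx hy => simp only [map_add, hx, hy, add_zero]
      | hmul x y hx hy => simp [pushRight_mul, hx, hy])

theorem pushLeft_mul (z x y : Amalgam j j') :
    pushLeft hB hbr z (x * y) =
      (1 ⊗ₜ[k] x) * pushLeft hB hbr z y + pushLeft hB hbr z x * (y ⊗ₜ[k] 1) :=
  extend_mul _ _ _ _ _ x y

theorem pushLeft_inl (x : Amalgam j j') (a : A) :
    pushLeft hB hbr x (inl j j' a) = pushRight hB hbr a x :=
  extend_inl _ _ _ _ _ a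

theorem pushLeft_inr (x : Amalgam j j') (a : A') :
    pushLeft hB hbr x (inr j j' a) = 0 :=
  extend_inr _ _ _ _ _ a

/-- The bracket on `A ∗_C A'` induced by a double bracket on `A` that is linear over `B ⊇ j(C)`:
it extends the given one (`pushBracket_inl_inl`), vanishes as soon as one argument is in `A'`
(`pushBracket_inr_left`, `pushBracket_inr_right`), and is a derivation in both arguments. -/
def pushBracket : Amalgam j j' →ₗ[k] Amalgam j j' →ₗ[k] Amalgam j j' ⊗[k] Amalgam j j' :=
  LinearMap.flip
  { toFun := pushLeft hB hbr
    map_add' := fun x y => by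
      refine derivation_ext Algebra.TensorProduct.includeRight Algebra.TensorProduct.includeLeft
        (pushLeft_mul hB hbr _) (fun x y => ?_) (fun c => ?_) (fun c => ?_)
      · simp only [LinearMap.add_apply, pushLeft_mul, mul_add, add_mul,
          Algebra.TensorProduct.includeLeft_apply, Algebra.TensorProduct.includeRight_apply]
        abel
      · simp [pushLeft_inl]
      · simp [pushLeft_inr]
    map_smul' := fun t x => by
      refine derivation_ext Algebra.TensorProduct.includeRight Algebra.TensorProduct.includeLeft
        (pushLeft_mul hB hbr _) (fun x y => ?_) (fun c => ?_) (fun c => ?_)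
      · simp [pushLeft_mul]
      · simp [pushLeft_inl]
      · simp [pushLeft_inr] }

theorem pushBracket_apply (x y : Amalgam j j') :
    pushBracket hB hbr x y = pushLeft hB hbr y x := rfl

theorem pushBracket_inl_inl (a b : A) :
    pushBracket hB hbr (inl j j' a) (inl j j' b) = inlTensor j j' (br a b) := by
  rw [pushBracket_apply, pushLeft_inl, pushRight_inl]

theorem pushBracket_mul_left (x y z : Amalgam j j') :
    pushBracket hB hbr (x * y) z =
      (1 ⊗ₜ[k] x) * pushBracket hB hbr y z + pushBracket hB hbr x z * (y ⊗ₜ[k] 1) := by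
  simp only [pushBracket_apply, pushLeft_mul]

theorem pushBracket_inr_left (a : A') (x : Amalgam j j') :
    pushBracket hB hbr (inr j j' a) x = 0 := by
  rw [pushBracket_apply, pushLeft_inr]

theorem pushBracket_inr_right (x : Amalgam j j') (a : A') :
    pushBracket hB hbr x (inr j j' a) = 0 := by
  induction x using Amalgam.induction with
  | hl b => rw [pushBracket_apply, pushLeft_inl, pushRight_inr]
  | hr b => exact pushBracket_inr_left hB hbr b _
  | hadd x y hx hy => rw [map_add, LinearMap.add_apply, hx, hy, add_zero]
  | hmul x y hx hy => rw [pushBracket_mul_left, hx, hy, mul_zero, zero_mul, add_zero]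

end

end Induced

end Amalgam

end Amalgam

/-! ### The fusion algebra -/

section Fusion

variable {k : Type*} [Field k] {A : Type*} [Ring A] [Algebra k A] {I : Type*} [Fintype I]
  {e : I → A} (he : CompleteOrthogonalIdempotents e) {p q : I} (hpq : p ≠ q)

variable (k) in
/-- The map `k e_p ⊕ k e_q ⊕ k μ → A`, with `μ = 1 - e_p - e_q`. -/
def baseMap : (k × k × k) →ₐ[k] A :=
  AlgHom.ofLinearMap
    { toFun := fun c => c.1 • e p + c.2.1 • e q + c.2.2 • (1 - e p - e q)
      map_add' := fun c d => by simp only [Prod.fst_add, Prod.snd_add, add_smul]; abel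
      map_smul' := fun t c => by simp [smul_smul, smul_add] }
    (by simp)
    (fun c d => by
      have h1 := (he.idem p).eq
      have h2 := (he.idem q).eq
      have h3 := he.ortho hpq
      have h4 := he.ortho hpq.symm
      simp only [LinearMap.coe_mk, AddHom.coe_mk, Prod.fst_mul, Prod.snd_mul, add_mul, mul_add,
        smul_mul_smul_comm, h1, h2, h3, h4, sub_mul, mul_sub, one_mul, mul_one, smul_zero,
        sub_self, sub_zero, add_zero, zero_add])

variable (k) in
/-- The map `k e_p ⊕ k e_q ⊕ k μ → Mat₂(k) ⊕ k μ`. -/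
def matMap : (k × k × k) →ₐ[k] (Matrix (Fin 2) (Fin 2) k × k) :=
  AlgHom.prod
    ((Matrix.diagonalAlgHom k).comp
      (AlgHom.pi (R := k) (A := fun _ : Fin 2 => k)
        ![AlgHom.fst k k (k × k), (AlgHom.fst k k k).comp (AlgHom.snd k k (k × k))]))
    ((AlgHom.snd k k k).comp (AlgHom.snd k k (k × k)))

variable (k) in
/-- The extension algebra `A ∗_{k e_p ⊕ k e_q ⊕ k μ} (Mat₂(k) ⊕ k μ)` of `A` along `(e_p, e_q)`. -/
abbrev ExtAlgebra : Type _ := Amalgam (baseMap k he hpq) (matMap k)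

variable (k) in
/-- The canonical map from `A` to the extension algebra. -/
def toExt : A →ₐ[k] ExtAlgebra k he hpq := Amalgam.inl _ _

variable (k) in
/-- The matrix unit `e_{12}` in the extension algebra; the index `1` of `Mat₂(k)` belongs to
`e_p`, and the index `2` to `e_q`. -/
def unit12 : ExtAlgebra k he hpq := Amalgam.inr _ _ (Matrix.single 0 1 1, 0)

variable (k) in
/-- The matrix unit `e_{21}` in the extension algebra. -/
def unit21 : ExtAlgebra k he hpq := Amalgam.inr _ _ (Matrix.single 1 0 1, 0)

variable (k) in
/-- The idempotent `ε = 1 - e_q` of the extension algebra. -/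
def eps : ExtAlgebra k he hpq := 1 - toExt k he hpq (e q)

variable (k) in
theorem eps_idem : IsIdempotentElem (eps k he hpq) :=
  ((he.idem q).map (toExt k he hpq)).one_sub

variable (k) in
/-- The fusion algebra `A^f = ε Ā ε`, obtained by fusing `e_q` onto `e_p`; its unit is `ε`. -/
abbrev FusionAlgebra : Type _ := (eps_idem k he hpq).Corner

/-- Scalars act on a corner `x R x` as on `R`. -/
@[reducible] def cornerModule {R : Type*} [Ring R] [Algebra k R] {x : R} (hx : IsIdempotentElem x) :
    Module k hx.Corner where
  smul t r := ⟨t • r.1, by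
    obtain ⟨y, hy⟩ := r.2
    exact ⟨t • y, by simp [← hy]⟩⟩
  one_smul r := Subtype.ext (one_smul k r.1)
  mul_smul s t r := Subtype.ext (mul_smul s t r.1)
  smul_zero t := Subtype.ext (smul_zero t)
  smul_add t r s := Subtype.ext (smul_add t r.1 s.1)
  add_smul s t r := Subtype.ext (add_smul s t r.1)
  zero_smul r := Subtype.ext (zero_smul k r.1)

instance cornerAlgebra {R : Type*} [Ring R] [Algebra k R] {x : R} (hx : IsIdempotentElem x) :
    Algebra k hx.Corner :=
  letI := cornerModule (k := k) hx
  Algebra.ofModule (fun t r s => Subtype.ext (smul_mul_assoc t r.1 s.1))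
    (fun t r s => Subtype.ext (mul_smul_comm t r.1 s.1))

/-- The inclusion `x R x → R`. -/
def cornerVal {R : Type*} [Ring R] [Algebra k R] {x : R} (hx : IsIdempotentElem x) :
    hx.Corner →ₗ[k] R where
  toFun r := r.1
  map_add' _ _ := rfl
  map_smul' _ _ := rfl

/-- The projection `R → x R x`, `r ↦ x r x`. -/
def cornerProj {R : Type*} [Ring R] [Algebra k R] {x : R} (hx : IsIdempotentElem x) :
    R →ₗ[k] hx.Corner where
  toFun r := ⟨x * r * x, ⟨r, rfl⟩⟩
  map_add' r s := Subtype.ext (by change x * (r + s) * x = x * r * x + x * s * x; noncomm_ring)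
  map_smul' t r := Subtype.ext (by change x * (t • r) * x = t • (x * r * x); simp)

variable (k) in
/-- The projection `x ↦ ε x ε` onto the fusion algebra. -/
def cut : ExtAlgebra k he hpq →ₗ[k] FusionAlgebra k he hpq := cornerProj (eps_idem k he hpq)

variable (k) in
/-- The trace map `Tr : A → A^f`, `a ↦ ε a ε + ε e_{12} a e_{21} ε`. -/
def trace (a : A) : FusionAlgebra k he hpq :=
  cut k he hpq (toExt k he hpq a)
    + cut k he hpq (unit12 k he hpq * toExt k he hpq a * unit21 k he hpq)

/-- The trace of a double derivation `δ` of the extension algebra, that is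
`ε δ ε + ε e_{12} δ e_{21} ε` for the inner bimodule structure:
`a ↦ δ(a)' ε ⊗ ε δ(a)'' + δ(a)' e_{21} ε ⊗ ε e_{12} δ(a)''`. -/
def traceDer (δ : ExtAlgebra k he hpq →ₗ[k] ExtAlgebra k he hpq ⊗[k] ExtAlgebra k he hpq) :
    FusionAlgebra k he hpq →ₗ[k] FusionAlgebra k he hpq ⊗[k] FusionAlgebra k he hpq :=
  (TensorProduct.map (cut k he hpq) (cut k he hpq)
    + TensorProduct.map (cut k he hpq ∘ₗ LinearMap.mulRight k (unit21 k he hpq))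
        (cut k he hpq ∘ₗ LinearMap.mulLeft k (unit12 k he hpq)))
    ∘ₗ δ ∘ₗ cornerVal (eps_idem k he hpq)

theorem baseMap_mem (c : k × k × k) : baseMap k he hpq c ∈ idemSubalgebra k e := by
  have h : ∀ s, e s ∈ idemSubalgebra k e := fun s => Algebra.subset_adjoin ⟨s, rfl⟩
  change c.1 • e p + c.2.1 • e q + c.2.2 • (1 - e p - e q) ∈ _
  exact add_mem (add_mem (Subalgebra.smul_mem _ (h p) _) (Subalgebra.smul_mem _ (h q) _))
    (Subalgebra.smul_mem _ (sub_mem (sub_mem (one_mem _) (h p)) (h q)) _)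

variable (k) in
/-- The double derivation `Tr(E_s)` of the fusion algebra, for the gauge element `E_s` of `A`. -/
def traceGauge (s : I) :
    FusionAlgebra k he hpq →ₗ[k] FusionAlgebra k he hpq ⊗[k] FusionAlgebra k he hpq :=
  traceDer he hpq (Amalgam.pushDer (baseMap_mem he hpq) (gauge_isDoubleDerivation (k := k) he s))

/-- The bracket on the fusion algebra induced by a double bracket on `A`. -/
def inducedBracket {br : A →ₗ[k] A →ₗ[k] A ⊗[k] A}
    (hbr : IsDoubleBracket (idemSubalgebra k e) br) :
    FusionAlgebra k he hpq →ₗ[k] FusionAlgebra k he hpq →ₗ[k]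
      FusionAlgebra k he hpq ⊗[k] FusionAlgebra k he hpq :=
  ((Amalgam.pushBracket (j' := matMap k) (baseMap_mem he hpq) hbr).compl₁₂
    (cornerVal (eps_idem k he hpq)) (cornerVal (eps_idem k he hpq))).compr₂
    (TensorProduct.map (cut k he hpq) (cut k he hpq))

/-- The bracket `⦃-,-⦄^f = ⦃-,-⦄ + ⦃-,-⦄_fus` on the fusion algebra, where `⦃-,-⦄_fus` is defined
by the bivector `-½ Tr(E_p) Tr(E_q)`. -/
def fusionBracket {br : A →ₗ[k] A →ₗ[k] A ⊗[k] A}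
    (hbr : IsDoubleBracket (idemSubalgebra k e) br) :
    FusionAlgebra k he hpq →ₗ[k] FusionAlgebra k he hpq →ₗ[k]
      FusionAlgebra k he hpq ⊗[k] FusionAlgebra k he hpq :=
  inducedBracket he hpq hbr
    + bivectorBracket (-(1 / 2 : k) • traceGauge k he hpq p) (traceGauge k he hpq q)

variable (k) in
/-- The idempotents `e_s`, `s ≠ q`, of the fusion algebra. -/
def fusionIdem (s : {s : I // s ≠ q}) : FusionAlgebra k he hpq :=
  cut k he hpq (toExt k he hpq (e s))

variable (k) in
/-- `Φ^f = e_p Tr(Φ_p) Tr(Φ_q) e_p + ∑_{s ≠ p, q} e_s Tr(Φ_s) e_s`, where `Φ_s = e_s Φ e_s`. -/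
def fusionMomentMap [DecidableEq I] (Φ : A) : FusionAlgebra k he hpq :=
  fusionIdem k he hpq ⟨p, hpq⟩ * trace k he hpq (e p * Φ * e p) * trace k he hpq (e q * Φ * e q)
      * fusionIdem k he hpq ⟨p, hpq⟩
    + ∑ s : {s : I // s ≠ q}, if s.1 = p then 0 else
        fusionIdem k he hpq s * trace k he hpq (e s * Φ * e s) * fusionIdem k he hpq s

end Fusion

end

end DoubleBracket

namespace DoubleBracket

noncomputable section

/-! ### Triple contractions and inner double derivations -/

section Generic

variable {k : Type*} [Field k] {R : Type*} [Ring R] [Algebra k R]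

/-! All computations take place in the extension algebra Ā, where `u = e₂₁` and `v = e₁₂` are
available, and are restricted to the corner `A^f = εĀε` at the end. The restriction loses nothing.
The inclusion of a corner is multiplicative and has a linear retraction, so it stays injective on
tensor powers; and a bracket or double derivation that is linear over `ε` sends elements of the
corner to tensors that cutting by `ε` leaves alone. Hence the fusion bracket and the gauge elements
of `A^f` are restrictions of objects on Ā (`map_fusionVal_fusionBracket`, `map_fusionVal_gauge`).
The gauge element of `e_p` extends as the inner derivation of `e_p ⊗ e_p + u ⊗ v`, which, unlike
that of `e_p ⊗ e_p`, kills `u` and `v`.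

Quasi-Poisson identity. Both sides are cyclic, are derivations in the last argument and vanish on
the matrix summand; for the right side this is visible once each eight-term summand is recognised as
a contraction of `E_s(a)`, `E_s(b)`, `E_s(c)` (`quasiPoisson_term_eq_contract₃`). By
`Amalgam.triple_eq_zero` it suffices to test on elements of `A`. There `Tr(E_p)` and `Tr(E_q)` agree
with the inner derivations of `vu ⊗ vu` and `u ⊗ v`, so the bivector bracket `F` is an explicit
expression in `u` and `v`. Let `P` be the extended bracket and expand the triple bracket of `P -
½F`. The part without `F` is known by hypothesis. The part linear in `F` vanishes
(`IsUnitPair.mixed_eq_zero`): `P` kills `u` and `v`, so only values of `P` on `A` survive, and they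
cancel. No presentation of `P` by a bivector is needed, which is why the bracket may be
non-differential. The quadratic part is `¼` times the cubic term of the fused idempotent minus those
of `e_p` and `e_q` (`IsUnitPair.triple_unitBracket`), exactly the change required.

Moment map. The fused component is `Φ_p v Φ_q u`. Expanding its bracket with `a ∈ A` by Leibniz
leaves four unwanted terms, which `-½F` exchanges for the four missing ones
(`IsUnitPair.bracket_moment`). The identity extends to Ā since both sides are derivations in `a`.
The inverse is written down from the corners of `Φ⁻¹`.

Finite generation comes from `1 = ε + uv`, which expresses `ε x y ε` through four corner entries of
`x` and of `y` (`cut_mul`). -/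

theorem comm_mul (x y : R ⊗[k] R) : TensorProduct.comm k R R (x * y) =
    TensorProduct.comm k R R x * TensorProduct.comm k R R y :=
  map_mul (Algebra.TensorProduct.comm k R R) x y

theorem tau_tmul (a b c : R) : tau k R (a ⊗ₜ[k] b ⊗ₜ[k] c) = c ⊗ₜ[k] a ⊗ₜ[k] b := by
  simp [tau]

theorem tau_mul (x y : (R ⊗[k] R) ⊗[k] R) : tau k R (x * y) = tau k R x * tau k R y := by
  induction x using TensorProduct.induction_on with
  | zero => simp
  | add x x' hx hx' => simp [add_mul, hx, hx']
  | tmul x c =>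
    induction y using TensorProduct.induction_on with
    | zero => simp
    | add y y' hy hy' => simp [mul_add, hy, hy']
    | tmul y d =>
      induction x using TensorProduct.induction_on with
      | zero => simp
      | add x x' hx hx' => simp only [TensorProduct.add_tmul, add_mul, map_add, hx, hx']
      | tmul x x' =>
        induction y using TensorProduct.induction_on with
        | zero => simp
        | add y y' hy hy' => simp only [TensorProduct.add_tmul, mul_add, map_add, hy, hy']
        | tmul y y' => simp [tau_tmul]

theorem tau_tau_tau (x : (R ⊗[k] R) ⊗[k] R) : tau k R (tau k R (tau k R x)) = x := by
  have : tau k R ∘ₗ tau k R ∘ₗ tau k R = LinearMap.id := by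
    ext a b c; simp [tau_tmul]
  exact LinearMap.congr_fun this x

/-- The double derivation `a ↦ a t - t a` for the outer bimodule structure. -/
def innerDer (t : R ⊗[k] R) : R →ₗ[k] R ⊗[k] R :=
  LinearMap.mulRight k t ∘ₗ (Algebra.TensorProduct.includeLeft : R →ₐ[k] R ⊗[k] R).toLinearMap
    - LinearMap.mulLeft k t ∘ₗ (Algebra.TensorProduct.includeRight : R →ₐ[k] R ⊗[k] R).toLinearMap

theorem innerDer_apply (t : R ⊗[k] R) (a : R) :
    innerDer t a = (a ⊗ₜ[k] 1) * t - t * (1 ⊗ₜ[k] a) := rfl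

theorem innerDer_mul (t : R ⊗[k] R) (a b : R) :
    innerDer t (a * b) = (a ⊗ₜ[k] 1) * innerDer t b + innerDer t a * (1 ⊗ₜ[k] b) := by
  have h1 : (a * b) ⊗ₜ[k] (1 : R) = (a ⊗ₜ[k] 1) * (b ⊗ₜ[k] 1) := by simp
  have h2 : (1 : R) ⊗ₜ[k] (a * b) = (1 ⊗ₜ[k] a) * (1 ⊗ₜ[k] b) := by simp
  rw [innerDer_apply, innerDer_apply, innerDer_apply, h1, h2]
  noncomm_ring

theorem gauge_eq_innerDer (x : R) : gauge k x = innerDer (x ⊗ₜ[k] x) := by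
  ext a; simp [gauge_apply, innerDer_apply]

variable (k R) in
/-- `(d, f) ↦ f' ⊗ d'' ⊗ d' f''`. -/
def chain : R ⊗[k] R →ₗ[k] R ⊗[k] R →ₗ[k] (R ⊗[k] R) ⊗[k] R :=
  TensorProduct.map₂ (TensorProduct.mk k R R).flip (LinearMap.mul k R) ∘ₗ
    (TensorProduct.comm k R R).toLinearMap

theorem chain_tmul (x y z w : R) :
    chain k R (x ⊗ₜ[k] y) (z ⊗ₜ[k] w) = z ⊗ₜ[k] y ⊗ₜ[k] (x * w) := by
  simp [chain]

/-- `(d₁, d₂, d₃) ↦ d₃' d₁'' ⊗ d₁' d₂'' ⊗ d₂' d₃''`. -/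
def contract₃ (d : R ⊗[k] R) : R ⊗[k] R →ₗ[k] R ⊗[k] R →ₗ[k] (R ⊗[k] R) ⊗[k] R :=
  (chain k R).compr₂ (LinearMap.rTensor R (contract k R d))

theorem contract₃_tmul (x y z w r s : R) :
    contract₃ (x ⊗ₜ[k] y) (z ⊗ₜ[k] w) (r ⊗ₜ[k] s) =
      (r * y) ⊗ₜ[k] (x * w) ⊗ₜ[k] (z * s) := by
  simp [contract₃, chain_tmul, contract_tmul]

theorem contract₃_zero : contract₃ (0 : R ⊗[k] R) = 0 := by
  ext; simp [contract₃]

theorem contract₃_add (c d : R ⊗[k] R) : contract₃ (c + d) = contract₃ c + contract₃ d := by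
  refine LinearMap.ext fun x => LinearMap.ext fun y => ?_
  simp [contract₃, LinearMap.rTensor_add]

theorem contract₃_sub (c d x y : R ⊗[k] R) :
    contract₃ (c - d) x y = contract₃ c x y - contract₃ d x y := by
  simp [contract₃, LinearMap.rTensor_sub]

/-- This cyclic symmetry turns the Leibniz rule in the last argument into one in every argument. -/
theorem tau_contract₃ (c d f : R ⊗[k] R) : tau k R (contract₃ d f c) = contract₃ c d f := by
  induction c using TensorProduct.induction_on with
  | zero => simp [contract₃_zero]
  | add x y hx hy => simp [contract₃_add, hx, hy]
  | tmul c c' =>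
  induction d using TensorProduct.induction_on with
  | zero => simp [contract₃_zero]
  | add x y hx hy => simp [contract₃_add, hx, hy]
  | tmul d d' =>
  induction f using TensorProduct.induction_on with
  | zero => simp
  | add x y hx hy => simp [hx, hy]
  | tmul f f' => simp [contract₃_tmul, tau_tmul]

theorem contract₃_outer (c d f : R ⊗[k] R) (x y : R) :
    contract₃ c d ((x ⊗ₜ[k] 1) * f * (1 ⊗ₜ[k] y)) =
      (x ⊗ₜ[k] 1 ⊗ₜ[k] 1) * contract₃ c d f * (1 ⊗ₜ[k] 1 ⊗ₜ[k] y) := by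
  induction c using TensorProduct.induction_on with
  | zero => simp [contract₃_zero]
  | add d d' hd hd' => simp [contract₃_add, hd, hd', mul_add, add_mul]
  | tmul c c' =>
  induction d using TensorProduct.induction_on with
  | zero => simp
  | add d d' hd hd' => simp [hd, hd', mul_add, add_mul]
  | tmul d d' =>
  induction f using TensorProduct.induction_on with
  | zero => simp
  | add f f' hf hf' => simp [hf, hf', mul_add, add_mul]
  | tmul f f' => simp [contract₃_tmul, mul_assoc]

/-- The contraction of three values of a double derivation is a derivation in the last argument. -/
theorem contract₃_leibniz {δ : R →ₗ[k] R ⊗[k] R}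
    (hδ : ∀ a b, δ (a * b) = (a ⊗ₜ[k] 1) * δ b + δ a * (1 ⊗ₜ[k] b)) (c d : R ⊗[k] R) (a b : R) :
    contract₃ c d (δ (a * b)) = (a ⊗ₜ[k] 1 ⊗ₜ[k] 1) * contract₃ c d (δ b)
      + contract₃ c d (δ a) * (1 ⊗ₜ[k] 1 ⊗ₜ[k] b) := by
  have h1 := contract₃_outer c d (δ b) a 1
  have h2 := contract₃_outer c d (δ a) 1 b
  simp only [← Algebra.TensorProduct.one_def, mul_one, one_mul] at h1 h2
  rw [hδ, map_add, h1, h2, Algebra.TensorProduct.one_def]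

/-- Each gauge element has two terms, so the contraction of three of them has 2³ = 8, with `x * x`
collapsing to `x` where two of them meet. In this form the right side of the quasi-Poisson condition
is visibly cyclic and a derivation in each argument. -/
theorem quasiPoisson_term_eq_contract₃ {x : R} (hx : IsIdempotentElem x) (a b c : R) :
    (c * x * a) ⊗ₜ[k] (x * b) ⊗ₜ[k] x - (c * x * a) ⊗ₜ[k] x ⊗ₜ[k] (b * x)
    - (c * x) ⊗ₜ[k] (a * x * b) ⊗ₜ[k] x + (c * x) ⊗ₜ[k] (a * x) ⊗ₜ[k] (b * x)
    - (x * a) ⊗ₜ[k] (x * b) ⊗ₜ[k] (x * c) + (x * a) ⊗ₜ[k] x ⊗ₜ[k] (b * x * c)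
    + x ⊗ₜ[k] (a * x * b) ⊗ₜ[k] (x * c) - x ⊗ₜ[k] (a * x) ⊗ₜ[k] (b * x * c) =
      contract₃ (gauge k x a) (gauge k x b) (gauge k x c) := by
  have h1 : ∀ y, x * (x * y) = x * y := fun y => by rw [← mul_assoc, hx.eq]
  simp only [gauge_apply, contract₃_sub, map_sub, LinearMap.sub_apply, contract₃_tmul, mul_assoc,
    hx.eq, h1]
  abel

/-! ### The triple bracket -/

section Triple

variable (br : R →ₗ[k] R →ₗ[k] R ⊗[k] R)

theorem brLeft_tmul (a x y : R) : brLeft br a (x ⊗ₜ[k] y) = br a x ⊗ₜ[k] y := by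
  simp [brLeft]

theorem tau_tripleBracket (a b c : R) :
    tau k R (tripleBracket br b c a) = tripleBracket br a b c := by
  simp only [tripleBracket, map_add, tau_tau_tau]
  abel

variable {br} in
theorem IsDoubleBracket.brLeft_mul_left {B : Subalgebra k R} (h : IsDoubleBracket B br) (a c : R)
    (w : R ⊗[k] R) : brLeft br a ((c ⊗ₜ[k] 1) * w) = (c ⊗ₜ[k] 1 ⊗ₜ[k] 1) * brLeft br a w
      + (br a c ⊗ₜ[k] 1) * (TensorProduct.assoc k R R R).symm (1 ⊗ₜ[k] w) := by
  induction w using TensorProduct.induction_on with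
  | zero => simp
  | add x y hx hy => simp only [mul_add, map_add, hx, hy, TensorProduct.tmul_add]; abel
  | tmul x y =>
    simp [brLeft_tmul, h.leibniz, TensorProduct.add_tmul, add_comm]

variable {br} in
-- The second summand has the same shape as the cross term of `IsDoubleBracket.brLeft_mul_left`; the
-- two cancel in the Leibniz rule for the triple bracket.
theorem IsDoubleBracket.tau_brLeft_mul_right {B : Subalgebra k R} (h : IsDoubleBracket B br)
    (b d : R) (w : R ⊗[k] R) : tau k R (brLeft br b (w * (d ⊗ₜ[k] 1))) =
      tau k R (brLeft br b w) * (1 ⊗ₜ[k] 1 ⊗ₜ[k] d) + (TensorProduct.comm k R R w ⊗ₜ[k] 1) *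
        (TensorProduct.assoc k R R R).symm (1 ⊗ₜ[k] br b d) := by
  induction w using TensorProduct.induction_on with
  | zero => simp
  | add x y hx hy =>
    simp only [add_mul, map_add, hx, hy, TensorProduct.add_tmul]; abel
  | tmul x y =>
    have h1 : ((br b x * (1 ⊗ₜ[k] d)) ⊗ₜ[k] y : (R ⊗[k] R) ⊗[k] R) =
        (br b x ⊗ₜ[k] y) * (1 ⊗ₜ[k] d ⊗ₜ[k] 1) := by simp
    have h2 : ∀ t : R ⊗[k] R, tau k R (((x ⊗ₜ[k] 1) * t) ⊗ₜ[k] y) =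
        (TensorProduct.comm k R R (x ⊗ₜ[k] y) ⊗ₜ[k] 1) *
          (TensorProduct.assoc k R R R).symm (1 ⊗ₜ[k] t) := fun t => by
      induction t using TensorProduct.induction_on with
      | zero => simp
      | add t t' ht ht' => simp only [mul_add, TensorProduct.add_tmul, TensorProduct.tmul_add,
          map_add, ht, ht']
      | tmul t t' => simp [tau_tmul]
    rw [Algebra.TensorProduct.tmul_mul_tmul, brLeft_tmul, h.leibniz, TensorProduct.add_tmul,
      map_add, mul_one, h2, h1, tau_mul, tau_tmul, brLeft_tmul]

theorem brLeft_inner_left (b c : R) (w : R ⊗[k] R) :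
    brLeft br b ((1 ⊗ₜ[k] c) * w) = (1 ⊗ₜ[k] 1 ⊗ₜ[k] c) * brLeft br b w := by
  induction w using TensorProduct.induction_on with
  | zero => simp
  | add x y hx hy => simp only [mul_add, map_add, hx, hy]
  | tmul x y => simp [brLeft_tmul, ← Algebra.TensorProduct.one_def]

theorem brLeft_outer_right (b c : R) (w : R ⊗[k] R) :
    brLeft br b (w * (1 ⊗ₜ[k] c)) = brLeft br b w * (1 ⊗ₜ[k] 1 ⊗ₜ[k] c) := by
  induction w using TensorProduct.induction_on with
  | zero => simp
  | add x y hx hy => simp only [add_mul, map_add, hx, hy]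
  | tmul x y => simp [brLeft_tmul, ← Algebra.TensorProduct.one_def]

variable {br} in
theorem IsDoubleBracket.brLeft_mul {B : Subalgebra k R} (h : IsDoubleBracket B br) (c d : R)
    (w : R ⊗[k] R) : brLeft br (c * d) w = (1 ⊗ₜ[k] c ⊗ₜ[k] 1) * brLeft br d w
      + brLeft br c w * (d ⊗ₜ[k] 1 ⊗ₜ[k] 1) := by
  induction w using TensorProduct.induction_on with
  | zero => simp
  | add x y hx hy => simp only [add_mul, mul_add, map_add, hx, hy]; abel
  | tmul x y => simp [brLeft_tmul, h.leibniz_left, TensorProduct.add_tmul]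

variable {br} in
/-- The triple bracket is a derivation in its last argument. -/
theorem IsDoubleBracket.tripleBracket_mul {B : Subalgebra k R} (h : IsDoubleBracket B br)
    (a b c d : R) : tripleBracket br a b (c * d) = (c ⊗ₜ[k] 1 ⊗ₜ[k] 1) * tripleBracket br a b d
      + tripleBracket br a b c * (1 ⊗ₜ[k] 1 ⊗ₜ[k] d) := by
  have h1 : ∀ (x : R ⊗[k] R) (y : (R ⊗[k] R) ⊗[k] R), ((-x) ⊗ₜ[k] 1) * y = -((x ⊗ₜ[k] 1) * y) :=
    fun x y => eq_neg_of_add_eq_zero_left (by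
      rw [← add_mul, ← TensorProduct.add_tmul, neg_add_cancel, TensorProduct.zero_tmul, zero_mul])
  -- Besides the expected terms there are two cross terms, both multiples of `1 ⊗ br b d`: one
  -- carries `br a c`, the other the flip of `br c a`. Antisymmetry makes them opposite, so no
  -- Jacobi-type condition enters.
  rw [tripleBracket, h.leibniz, h.leibniz_left, map_add, map_add, map_add, brLeft_outer_right,
    h.brLeft_mul_left, h.tau_brLeft_mul_right, brLeft_inner_left, h.brLeft_mul, map_add, map_add,
    tau_mul, tau_mul, tau_mul, tau_mul, tau_mul, tau_tmul, tau_tmul, tau_tmul, tau_tmul, tau_tmul,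
    h.antisymm a c, h1, tripleBracket, tripleBracket]
  simp only [mul_add, add_mul]
  abel

end Triple

end Generic

/-! ### Brackets of bivectors -/

section Bivector

variable {k : Type*} [Field k] {R : Type*} [Ring R] [Algebra k R]

theorem comm_contract (d f : R ⊗[k] R) :
    TensorProduct.comm k R R (contract k R d f) = contract k R f d := by
  induction d using TensorProduct.induction_on with
  | zero => simp
  | add x y hx hy => simp [hx, hy]
  | tmul x y =>
    induction f using TensorProduct.induction_on with
    | zero => simp
    | add x y hx hy => simp [hx, hy]
    | tmul z w => simp [contract_tmul]

theorem contract_mul_left (d f : R ⊗[k] R) (x : R) :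
    contract k R d ((x ⊗ₜ[k] 1) * f) = (x ⊗ₜ[k] 1) * contract k R d f := by
  induction d using TensorProduct.induction_on with
  | zero => simp
  | add x y hx hy => simp [hx, hy, mul_add]
  | tmul x y =>
    induction f using TensorProduct.induction_on with
    | zero => simp
    | add x y hx hy => simp [hx, hy, mul_add]
    | tmul z w => simp [contract_tmul, mul_assoc]

theorem contract_mul_right (d f : R ⊗[k] R) (x : R) :
    contract k R d (f * (1 ⊗ₜ[k] x)) = contract k R d f * (1 ⊗ₜ[k] x) := by
  induction d using TensorProduct.induction_on with
  | zero => simp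
  | add x y hx hy => simp [hx, hy, add_mul]
  | tmul x y =>
    induction f using TensorProduct.induction_on with
    | zero => simp
    | add x y hx hy => simp [hx, hy, add_mul]
    | tmul z w => simp [contract_tmul, mul_assoc]

theorem bivectorBracket_apply (δ₁ δ₂ : R →ₗ[k] R ⊗[k] R) (b c : R) :
    bivectorBracket δ₁ δ₂ b c = contract k R (δ₁ b) (δ₂ c) - contract k R (δ₂ b) (δ₁ c) := rfl

theorem bivectorBracket_smul (t : k) (δ₁ δ₂ : R →ₗ[k] R ⊗[k] R) :
    bivectorBracket (t • δ₁) δ₂ = t • bivectorBracket δ₁ δ₂ := by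
  refine LinearMap.ext fun b => LinearMap.ext fun c => ?_
  simp [bivectorBracket_apply, smul_sub]

/-- The flip exchanges the two arguments of `contract`, which gives antisymmetry, and `contract` is
linear for the outer structure in its second argument, which gives the Leibniz rule. -/
theorem isDoubleBracket_bivectorBracket {B : Subalgebra k R} {δ₁ δ₂ : R →ₗ[k] R ⊗[k] R}
    (h₁ : IsDoubleDerivation B δ₁) (h₂ : IsDoubleDerivation B δ₂) :
    IsDoubleBracket B (bivectorBracket δ₁ δ₂) where
  antisymm a b := by simp [bivectorBracket_apply, comm_contract]
  leibniz a b c := by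
    simp only [bivectorBracket_apply, h₁.leibniz, h₂.leibniz, map_add, contract_mul_left,
      contract_mul_right, sub_mul, mul_sub]
    abel
  vanish_left b hb a := by simp [bivectorBracket_apply, h₁.vanish b hb, h₂.vanish b hb]
  vanish_right b hb a := by simp [bivectorBracket_apply, h₁.vanish b hb, h₂.vanish b hb]

theorem IsDoubleBracket.add {B : Subalgebra k R} {br br' : R →ₗ[k] R →ₗ[k] R ⊗[k] R}
    (h : IsDoubleBracket B br) (h' : IsDoubleBracket B br') : IsDoubleBracket B (br + br') where
  antisymm a b := by
    rw [LinearMap.add_apply, LinearMap.add_apply, h.antisymm, h'.antisymm, LinearMap.add_apply,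
      LinearMap.add_apply, map_add, neg_add]
  leibniz a b c := by
    simp only [LinearMap.add_apply, h.leibniz, h'.leibniz, add_mul, mul_add]
    abel
  vanish_left b hb a := by simp [h.vanish_left b hb, h'.vanish_left b hb]
  vanish_right b hb a := by simp [h.vanish_right b hb, h'.vanish_right b hb]

theorem IsDoubleBracket.smul {B : Subalgebra k R} {br : R →ₗ[k] R →ₗ[k] R ⊗[k] R}
    (h : IsDoubleBracket B br) (t : k) : IsDoubleBracket B (t • br) where
  antisymm a b := by
    rw [LinearMap.smul_apply, LinearMap.smul_apply, h.antisymm, LinearMap.smul_apply,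
      LinearMap.smul_apply, map_smul, smul_neg]
  leibniz a b c := by simp [h.leibniz]
  vanish_left b hb a := by simp [h.vanish_left b hb]
  vanish_right b hb a := by simp [h.vanish_right b hb]

end Bivector

/-! ### Transport along multiplicative maps -/

section Transport

variable {k : Type*} [Field k] {R S : Type*} [Ring R] [Algebra k R] [Ring S] [Algebra k S]
  (f : R →ₗ[k] S)

/-- Multiplicativity suffices and `f 1 = 1` is not required, so the lemma covers the non-unital
inclusion of a corner. -/
theorem map_contract (hf : ∀ x y, f (x * y) = f x * f y) (c d : R ⊗[k] R) :
    TensorProduct.map f f (contract k R c d) =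
      contract k S (TensorProduct.map f f c) (TensorProduct.map f f d) := by
  induction c using TensorProduct.induction_on with
  | zero => simp
  | add x y hx hy => simp [hx, hy]
  | tmul x y =>
    induction d using TensorProduct.induction_on with
    | zero => simp
    | add x y hx hy => simp [hx, hy]
    | tmul z w => simp [contract_tmul, hf]

theorem map_contract₃ (hf : ∀ x y, f (x * y) = f x * f y) (c d g : R ⊗[k] R) :
    TensorProduct.map (TensorProduct.map f f) f (contract₃ c d g) =
      contract₃ (TensorProduct.map f f c) (TensorProduct.map f f d) (TensorProduct.map f f g) := by
  induction c using TensorProduct.induction_on with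
  | zero => simp [contract₃_zero]
  | add x y hx hy => simp [contract₃_add, hx, hy]
  | tmul x y =>
    induction d using TensorProduct.induction_on with
    | zero => simp
    | add x y hx hy => simp [hx, hy]
    | tmul z w =>
      induction g using TensorProduct.induction_on with
      | zero => simp
      | add x y hx hy => simp [hx, hy]
      | tmul r s => simp [contract₃_tmul, hf]

theorem map_tau (w : (R ⊗[k] R) ⊗[k] R) :
    TensorProduct.map (TensorProduct.map f f) f (tau k R w) =
      tau k S (TensorProduct.map (TensorProduct.map f f) f w) := by
  have : TensorProduct.map (TensorProduct.map f f) f ∘ₗ tau k R =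
      tau k S ∘ₗ TensorProduct.map (TensorProduct.map f f) f := by
    ext a b c; simp [tau_tmul]
  exact LinearMap.congr_fun this w

variable {f} in
theorem map_tripleBracket {br : R →ₗ[k] R →ₗ[k] R ⊗[k] R} {br' : S →ₗ[k] S →ₗ[k] S ⊗[k] S}
    (h : ∀ a b, TensorProduct.map f f (br a b) = br' (f a) (f b)) (a b c : R) :
    TensorProduct.map (TensorProduct.map f f) f (tripleBracket br a b c) =
      tripleBracket br' (f a) (f b) (f c) := by
  have key : ∀ a w, TensorProduct.map (TensorProduct.map f f) f (brLeft br a w) =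
      brLeft br' (f a) (TensorProduct.map f f w) := fun a w => by
    induction w using TensorProduct.induction_on with
    | zero => simp
    | add x y hx hy => simp [hx, hy]
    | tmul x y => simp [brLeft_tmul, h]
  simp only [tripleBracket, map_add, map_tau, key, h]

end Transport

/-! ### The triple bracket of the fusion bivector -/

section FusionBivector

variable {k : Type*} [Field k] {R : Type*} [Ring R] [Algebra k R]

/-- The relations between the matrix units `u = e₂₁` and `v = e₁₂`. -/
structure IsUnitPair (u v : R) : Prop where
  uu : u * u = 0
  vv : v * v = 0
  uvu : u * (v * u) = u
  vuv : v * (u * v) = v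

variable (k) in
/-- The bracket of the bivector formed by the inner double derivations of `e₁₁ ⊗ e₁₁` and
`e₂₁ ⊗ e₁₂`. -/
def unitBracket (u v : R) : R →ₗ[k] R →ₗ[k] R ⊗[k] R :=
  bivectorBracket (innerDer ((v * u) ⊗ₜ[k] (v * u))) (innerDer (u ⊗ₜ[k] v))

variable {u v : R}

theorem IsUnitPair.unitBracket_apply (h : IsUnitPair u v) (a x : R) :
    unitBracket k u v a x = (x * u) ⊗ₜ[k] (a * v) - (x * u * a) ⊗ₜ[k] v - u ⊗ₜ[k] (a * v * x)
      + (u * a) ⊗ₜ[k] (v * x) - (x * v) ⊗ₜ[k] (a * u) + (x * v * a) ⊗ₜ[k] u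
      + v ⊗ₜ[k] (a * u * x) - (v * a) ⊗ₜ[k] (u * x) := by
  have h1 : ∀ y, u * (v * (u * y)) = u * y := fun y => by
    rw [← mul_assoc v, ← mul_assoc u, h.uvu]
  have h2 : ∀ y, v * (u * (v * y)) = v * y := fun y => by
    rw [← mul_assoc u, ← mul_assoc v, h.vuv]
  simp only [unitBracket, bivectorBracket_apply, innerDer_apply,
    Algebra.TensorProduct.tmul_mul_tmul, one_mul, mul_one, map_sub, LinearMap.sub_apply,
    contract_tmul, mul_assoc, h1, h2, h.uvu, h.vuv]
  abel

variable (k u v) in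
/-- The part of `⦃a, ⦃b, c⦄'⦄ ⊗ ⦃b, c⦄''` that is linear in `w = ⦃a, b⦄`, where the inner bracket
is `unitBracket`. -/
def unitBracketLeft (c : R) : R ⊗[k] R →ₗ[k] (R ⊗[k] R) ⊗[k] R :=
  -((TensorProduct.mk k (R ⊗[k] R) R).flip v ∘ₗ LinearMap.mulLeft k ((c * u) ⊗ₜ[k] 1))
    + (TensorProduct.mk k (R ⊗[k] R) R).flip (v * c) ∘ₗ LinearMap.mulLeft k (u ⊗ₜ[k] 1)
    + (TensorProduct.mk k (R ⊗[k] R) R).flip u ∘ₗ LinearMap.mulLeft k ((c * v) ⊗ₜ[k] 1)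
    - (TensorProduct.mk k (R ⊗[k] R) R).flip (u * c) ∘ₗ LinearMap.mulLeft k (v ⊗ₜ[k] 1)

variable (k u v) in
/-- The part of `⦃a, ⦃b, c⦄'⦄ ⊗ ⦃b, c⦄''` that is linear in `w = ⦃a, c⦄`, where the inner bracket
is `unitBracket`. -/
def unitBracketRight (b : R) : R ⊗[k] R →ₗ[k] (R ⊗[k] R) ⊗[k] R :=
  (TensorProduct.mk k (R ⊗[k] R) R).flip (b * v) ∘ₗ LinearMap.mulRight k (1 ⊗ₜ[k] u)
    - (TensorProduct.mk k (R ⊗[k] R) R).flip v ∘ₗ LinearMap.mulRight k (1 ⊗ₜ[k] (u * b))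
    - (TensorProduct.mk k (R ⊗[k] R) R).flip (b * u) ∘ₗ LinearMap.mulRight k (1 ⊗ₜ[k] v)
    + (TensorProduct.mk k (R ⊗[k] R) R).flip u ∘ₗ LinearMap.mulRight k (1 ⊗ₜ[k] (v * b))

theorem unitBracketLeft_apply (c : R) (w : R ⊗[k] R) : unitBracketLeft k u v c w =
    -((((c * u) ⊗ₜ[k] 1) * w) ⊗ₜ[k] v) + ((u ⊗ₜ[k] 1) * w) ⊗ₜ[k] (v * c)
      + (((c * v) ⊗ₜ[k] 1) * w) ⊗ₜ[k] u - ((v ⊗ₜ[k] 1) * w) ⊗ₜ[k] (u * c) := by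
  simp [unitBracketLeft]

theorem unitBracketRight_apply (b : R) (w : R ⊗[k] R) : unitBracketRight k u v b w =
    (w * (1 ⊗ₜ[k] u)) ⊗ₜ[k] (b * v) - (w * (1 ⊗ₜ[k] (u * b))) ⊗ₜ[k] v
      - (w * (1 ⊗ₜ[k] v)) ⊗ₜ[k] (b * u) + (w * (1 ⊗ₜ[k] (v * b))) ⊗ₜ[k] u := by
  simp [unitBracketRight]

/-- `br a` kills `u` and `v`, so the Leibniz rule differentiates only the letters `b` and `c`. The
lemma does not apply with `unitBracket` itself as outer bracket, since inner derivations need not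
kill `u` and `v`. -/
theorem IsUnitPair.brLeft_unitBracket (h : IsUnitPair u v) {B : Subalgebra k R}
    {br : R →ₗ[k] R →ₗ[k] R ⊗[k] R} (hbr : IsDoubleBracket B br) (hu : u ∈ B) (hv : v ∈ B)
    (a b c : R) : brLeft br a (unitBracket k u v b c) =
      unitBracketLeft k u v c (br a b) + unitBracketRight k u v b (br a c) := by
  have h1 : ∀ x y : R, (1 : R) ⊗ₜ[k] (x * y) = (1 ⊗ₜ[k] x) * (1 ⊗ₜ[k] y) := by simp
  have h2 : ∀ x y : R, (x * y) ⊗ₜ[k] (1 : R) = (x ⊗ₜ[k] 1) * (y ⊗ₜ[k] 1) := by simp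
  simp only [h.unitBracket_apply, map_sub, map_add, brLeft_tmul, hbr.leibniz,
    hbr.vanish_right u hu, hbr.vanish_right v hv, unitBracketLeft_apply, unitBracketRight_apply,
    mul_zero, zero_mul, add_zero, zero_add, TensorProduct.zero_tmul, TensorProduct.add_tmul,
    h1, h2, mul_assoc]
  abel

/-- With `w = P(b, c)`, these are all the terms of the mixed triple bracket that contain `P(b, c)`
or `P(c, b) = -P(b, c)°`; this is the source of the flip and of the last sign. The cancellation
holds for every tensor `w`. -/
theorem IsUnitPair.unitBracket_cocycle (h : IsUnitPair u v) (a : R) (w : R ⊗[k] R) :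
    brLeft (unitBracket k u v) a w + tau k R (unitBracketLeft k u v a w)
      - tau k R (tau k R (unitBracketRight k u v a (TensorProduct.comm k R R w))) = 0 := by
  induction w using TensorProduct.induction_on with
  | zero => simp
  | add x y hx hy =>
    simp only [map_add]
    rw [← add_zero (0 : (R ⊗[k] R) ⊗[k] R)]
    nth_rewrite 1 [← hx]
    rw [← hy]
    abel
  | tmul x y =>
    simp only [brLeft_tmul, h.unitBracket_apply, unitBracketLeft_apply, unitBracketRight_apply,
      TensorProduct.comm_tmul, Algebra.TensorProduct.tmul_mul_tmul, one_mul, mul_one, map_sub,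
      map_add, map_neg, tau_tmul, TensorProduct.sub_tmul, TensorProduct.add_tmul, mul_assoc]
    abel

/-- A double bracket linear over the matrix units commutes with the fusion bivector. -/
theorem IsUnitPair.mixed_eq_zero (h : IsUnitPair u v) {B : Subalgebra k R}
    {br : R →ₗ[k] R →ₗ[k] R ⊗[k] R} (hbr : IsDoubleBracket B br) (hu : u ∈ B) (hv : v ∈ B)
    (a b c : R) :
    brLeft br a (unitBracket k u v b c) + tau k R (brLeft br b (unitBracket k u v c a))
      + tau k R (tau k R (brLeft br c (unitBracket k u v a b)))
      + (brLeft (unitBracket k u v) a (br b c) + tau k R (brLeft (unitBracket k u v) b (br c a))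
      + tau k R (tau k R (brLeft (unitBracket k u v) c (br a b)))) = 0 := by
  -- The mixed terms split into three groups, according to the pair of arguments inside `br`; each
  -- group is a cyclic rotation of the cocycle identity.
  have h1 := h.unitBracket_cocycle a (br b c)
  have h2 := congrArg (tau k R) (h.unitBracket_cocycle b (br c a))
  have h3 := congrArg (tau k R) (congrArg (tau k R) (h.unitBracket_cocycle c (br a b)))
  have e1 : TensorProduct.comm k R R (br b c) = -br c b := by rw [hbr.antisymm c b, neg_neg]
  have e2 : TensorProduct.comm k R R (br c a) = -br a c := by rw [hbr.antisymm a c, neg_neg]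
  have e3 : TensorProduct.comm k R R (br a b) = -br b a := by rw [hbr.antisymm b a, neg_neg]
  simp only [map_add, map_sub, map_neg, map_zero, tau_tau_tau, e1, e2, e3] at h1 h2 h3
  simp only [h.brLeft_unitBracket hbr hu hv, map_add]
  -- The right side becomes `0 + 0 + 0`, and each zero is replaced by one of the three identities.
  rw [← add_zero (0 : (R ⊗[k] R) ⊗[k] R), ← add_zero ((0 : (R ⊗[k] R) ⊗[k] R) + 0)]
  nth_rewrite 1 [← h1]
  nth_rewrite 1 [← h2]
  rw [← h3]
  abel

end FusionBivector

/-! ### The quadratic term and the expansion of the triple bracket of a sum -/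

section FusionBivector

variable {k : Type*} [Field k] {R : Type*} [Ring R] [Algebra k R] {u v : R}

variable (k u v) in
/-- The inner double derivation of `e₁₁ ⊗ e₁₁ + e₂₁ ⊗ e₁₂`. -/
def unitDer : R →ₗ[k] R ⊗[k] R := innerDer ((v * u) ⊗ₜ[k] (v * u) + u ⊗ₜ[k] v)

/-- Write `unitDer = D₁ + D₂` with `D₁`, `D₂` the inner derivations of `vu ⊗ vu` and `u ⊗ v`. The
pure `D₁` contraction is the gauge term of `vu`. The pure `D₂` contraction is the gauge term of
`uv`, because in every slot a `u` meets a `v` in this order. The right side therefore consists of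
the contractions that involve both derivations, and these match the triple bracket of the bivector
`D₁D₂` after reduction by the relations of a unit pair. -/
theorem IsUnitPair.triple_unitBracket (h : IsUnitPair u v) (a b c : R) :
    unitBracketLeft k u v c (unitBracket k u v a b)
        + unitBracketRight k u v b (unitBracket k u v a c)
      + tau k R (unitBracketLeft k u v a (unitBracket k u v b c)
        + unitBracketRight k u v c (unitBracket k u v b a))
      + tau k R (tau k R (unitBracketLeft k u v b (unitBracket k u v c a)
        + unitBracketRight k u v a (unitBracket k u v c b))) =
    contract₃ (unitDer k u v a) (unitDer k u v b) (unitDer k u v c)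
      - contract₃ (gauge k (v * u) a) (gauge k (v * u) b) (gauge k (v * u) c)
      - contract₃ (gauge k (u * v) a) (gauge k (u * v) b) (gauge k (u * v) c) := by
  have h1 : ∀ y, u * (v * (u * y)) = u * y := fun y => by
    rw [← mul_assoc v, ← mul_assoc u, h.uvu]
  have h2 : ∀ y, v * (u * (v * y)) = v * y := fun y => by
    rw [← mul_assoc u, ← mul_assoc v, h.vuv]
  have h3 : ∀ y, u * (u * y) = 0 := fun y => by rw [← mul_assoc, h.uu, zero_mul]
  have h4 : ∀ y, v * (v * y) = 0 := fun y => by rw [← mul_assoc, h.vv, zero_mul]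
  simp only [h.unitBracket_apply, unitBracketLeft_apply, unitBracketRight_apply,
    Algebra.TensorProduct.tmul_mul_tmul, one_mul, mul_one, mul_assoc, h3, h4, h.uu, h.vv, mul_zero,
    TensorProduct.zero_tmul, TensorProduct.tmul_zero, add_zero, zero_add, sub_zero,
    zero_sub, neg_zero, map_add, map_sub, map_neg, tau_tmul]
  simp only [unitDer, gauge_eq_innerDer, innerDer_apply, mul_add,
    add_mul, Algebra.TensorProduct.tmul_mul_tmul,
    one_mul, mul_one, mul_assoc, contract₃_sub, contract₃_add, map_add, map_sub,
    LinearMap.add_apply, LinearMap.sub_apply, contract₃_tmul, h1, h2, h.uvu, h.vuv]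
  abel

/-- The triple bracket of the sum of a double bracket and a bracket `F` that agrees with
`unitBracket` on `S`. -/
theorem IsUnitPair.tripleBracket_add_smul (h : IsUnitPair u v) {B : Subalgebra k R}
    {P F : R →ₗ[k] R →ₗ[k] R ⊗[k] R} (hP : IsDoubleBracket B P) (hF : IsDoubleBracket B F)
    (hu : u ∈ B) (hv : v ∈ B) {S : Set R}
    (hFS : ∀ a ∈ S, ∀ b ∈ S, F a b = unitBracket k u v a b)
    (hFP : ∀ a ∈ S, ∀ b ∈ S, ∀ c ∈ S,
      brLeft F a (P b c) = brLeft (unitBracket k u v) a (P b c)) (t : k)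
    {a b c : R} (ha : a ∈ S) (hb : b ∈ S) (hc : c ∈ S) :
    tripleBracket (P + t • F) a b c = tripleBracket P a b c + (t * t) •
      (contract₃ (unitDer k u v a) (unitDer k u v b) (unitDer k u v c)
      - contract₃ (gauge k (v * u) a) (gauge k (v * u) b) (gauge k (v * u) c)
      - contract₃ (gauge k (u * v) a) (gauge k (u * v) b) (gauge k (u * v) c)) := by
  have hsplit : ∀ a w, brLeft (P + t • F) a w = brLeft P a w + t • brLeft F a w := fun a w => by
    rw [brLeft, LinearMap.add_apply, LinearMap.smul_apply, LinearMap.rTensor_add,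
      LinearMap.rTensor_smul]
    rfl
  have hQ : ∀ a ∈ S, ∀ b ∈ S, (P + t • F) a b = P a b + t • unitBracket k u v a b :=
    fun a ha b hb => by rw [← hFS a ha b hb]; rfl
  have hmix := h.mixed_eq_zero hP hu hv a b c
  -- The outer bracket is `F`, which kills `u` and `v`, so the splitting into left and right parts
  -- is available; the remaining values `F a b` and `F a c` are then those of `unitBracket`.
  have hbr : ∀ a ∈ S, ∀ b ∈ S, ∀ c ∈ S, brLeft F a (unitBracket k u v b c) =
      unitBracketLeft k u v c (unitBracket k u v a b)
        + unitBracketRight k u v b (unitBracket k u v a c) := fun a ha b hb c hc => by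
    rw [h.brLeft_unitBracket hF hu hv, hFS a ha b hb, hFS a ha c hc]
  -- The coefficient of `t` is absent from the right side; it is inserted as `t • 0`, with `0`
  -- replaced by the mixed terms. What is left is a comparison of coefficients in `t`.
  rw [← h.triple_unitBracket, ← hbr a ha b hb c hc, ← hbr b hb c hc a ha, ← hbr c hc a ha b hb,
    ← add_zero (tripleBracket P a b c), ← smul_zero t, ← hmix, tripleBracket, tripleBracket,
    hQ b hb c hc, hQ c hc a ha, hQ a ha b hb, hsplit, hsplit, hsplit]
  simp only [map_add, map_smul, hFP a ha b hb c hc, hFP b hb c hc a ha, hFP c hc a ha b hb]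
  module

end FusionBivector

/-! ### Vanishing on generated subalgebras -/

section Adjoin

variable {k : Type*} [Field k] {R : Type*} [Ring R] [Algebra k R]

theorem isDoubleDerivation_adjoin {S : Set R} {δ : R →ₗ[k] R ⊗[k] R}
    (hl : ∀ a b, δ (a * b) = (a ⊗ₜ[k] 1) * δ b + δ a * (1 ⊗ₜ[k] b)) (hS : ∀ x ∈ S, δ x = 0) :
    IsDoubleDerivation (Algebra.adjoin k S) δ := by
  refine ⟨hl, fun x hx => ?_⟩
  have h1 : δ 1 = 0 := by
    have h := hl 1 1
    rwa [← Algebra.TensorProduct.one_def, mul_one, mul_one, one_mul, left_eq_add] at h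
  induction hx using Algebra.adjoin_induction with
  | mem x hx => exact hS x hx
  | algebraMap r => rw [Algebra.algebraMap_eq_smul_one, map_smul, h1, smul_zero]
  | add x y _ _ hx hy => rw [map_add, hx, hy, add_zero]
  | mul x y _ _ hx hy => rw [hl, hx, hy, mul_zero, zero_mul, add_zero]

theorem isDoubleBracket_adjoin {S : Set R} {br : R →ₗ[k] R →ₗ[k] R ⊗[k] R}
    (ha : ∀ a b : R, br a b = -TensorProduct.comm k R R (br b a))
    (hl : ∀ a b c : R, br a (b * c) = br a b * (1 ⊗ₜ[k] c) + (b ⊗ₜ[k] 1) * br a c)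
    (hS : ∀ x ∈ S, ∀ a, br a x = 0) : IsDoubleBracket (Algebra.adjoin k S) br := by
  have h0 : ∀ b ∈ Algebra.adjoin k S, ∀ a, br a b = 0 := fun b hb a =>
    (isDoubleDerivation_adjoin (δ := br a) (fun x y => by rw [hl, add_comm])
      (fun x hx => hS x hx a)).vanish b hb
  exact ⟨ha, hl, fun b hb a => by rw [ha, h0 b hb, map_zero, neg_zero], h0⟩

theorem IsDoubleDerivation.mul_mul {B : Subalgebra k R} {δ : R →ₗ[k] R ⊗[k] R}
    (h : IsDoubleDerivation B δ) {x y : R} (hx : x ∈ B) (hy : y ∈ B) (a : R) :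
    δ (x * a * y) = (x ⊗ₜ[k] 1) * δ a * (1 ⊗ₜ[k] y) := by
  rw [h.leibniz, h.leibniz, h.vanish x hx, h.vanish y hy]
  simp

end Adjoin

/-! ### The extended bracket -/

namespace Amalgam

variable {k : Type*} [Field k] {C A A' : Type*} [Ring C] [Algebra k C] [Ring A] [Algebra k A]
  [Ring A'] [Algebra k A'] {j : C →ₐ[k] A} {j' : C →ₐ[k] A'} {B : Subalgebra k A}
  (hB : ∀ c, j c ∈ B)

theorem pushDer_mul {δ : A →ₗ[k] A ⊗[k] A} (hδ : IsDoubleDerivation B δ) (x y : Amalgam j j') :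
    pushDer hB hδ (x * y) = (x ⊗ₜ[k] 1) * pushDer hB hδ y + pushDer hB hδ x * (1 ⊗ₜ[k] y) :=
  extend_mul _ _ _ _ _ x y

theorem pushDer_inl {δ : A →ₗ[k] A ⊗[k] A} (hδ : IsDoubleDerivation B δ) (a : A) :
    pushDer hB hδ (inl j j' a) = inlTensor j j' (δ a) :=
  extend_inl _ _ _ _ _ a

theorem pushDer_inr {δ : A →ₗ[k] A ⊗[k] A} (hδ : IsDoubleDerivation B δ) (a : A') :
    pushDer hB hδ (inr j j' a) = 0 :=
  extend_inr _ _ _ _ _ a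

variable {br : A →ₗ[k] A →ₗ[k] A ⊗[k] A} (hbr : IsDoubleBracket B br)

theorem tmul_one_mul_comm (x y : Amalgam j j') (w : Amalgam j j' ⊗[k] Amalgam j j') :
    (1 ⊗ₜ[k] x) * ((y ⊗ₜ[k] 1) * w) = (y ⊗ₜ[k] 1) * ((1 ⊗ₜ[k] x) * w) := by
  rw [← mul_assoc, ← mul_assoc]; simp

theorem mul_tmul_one_comm (x y : Amalgam j j') (w : Amalgam j j' ⊗[k] Amalgam j j') :
    w * (1 ⊗ₜ[k] x) * (y ⊗ₜ[k] 1) = w * (y ⊗ₜ[k] 1) * (1 ⊗ₜ[k] x) := by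
  rw [mul_assoc, mul_assoc]; simp

/-- The bracket is constructed as a derivation in `x`, so the rule in the other argument needs an
induction on `x`. The inductive step for products works because the inner and outer bimodule
structures commute. -/
theorem pushBracket_mul_right (x y z : Amalgam j j') :
    pushBracket hB hbr x (y * z) =
      pushBracket hB hbr x y * (1 ⊗ₜ[k] z) + (y ⊗ₜ[k] 1) * pushBracket hB hbr x z := by
  induction x using Amalgam.induction with
  | hl a => simp only [pushBracket_apply, pushLeft_inl, pushRight_mul, add_comm]
  | hr a => simp [pushBracket_inr_left]
  | hadd x x' hx hx' =>
    simp only [map_add, LinearMap.add_apply, hx, hx', add_mul, mul_add]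
    abel
  | hmul x x' hx hx' =>
    simp only [pushBracket_mul_left, hx, hx', mul_add, add_mul, tmul_one_mul_comm,
      mul_tmul_one_comm]
    simp only [mul_assoc]
    abel

theorem pushBracket_antisymm (x y : Amalgam j j') : pushBracket hB hbr x y =
    -TensorProduct.comm k (Amalgam j j') (Amalgam j j') (pushBracket hB hbr y x) := by
  induction x using Amalgam.induction with
  | hl a =>
    induction y using Amalgam.induction with
    | hl b =>
      have h : ∀ w : A ⊗[k] A, inlTensor j j' (TensorProduct.comm k A A w) =
          TensorProduct.comm k (Amalgam j j') (Amalgam j j') (inlTensor j j' w) := fun w => by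
        induction w using TensorProduct.induction_on with
        | zero => simp
        | add x y hx hy => simp [hx, hy]
        | tmul x y => simp [inlTensor_tmul]
      rw [pushBracket_inl_inl, pushBracket_inl_inl, hbr.antisymm, map_neg, h]
    | hr b => rw [pushBracket_inr_left, pushBracket_inr_right]; simp
    | hadd y y' hy hy' =>
      rw [map_add, map_add, LinearMap.add_apply, hy, hy', map_add]
      abel
    | hmul y y' hy hy' =>
      rw [pushBracket_mul_right, pushBracket_mul_left, hy, hy', map_add, comm_mul, comm_mul]
      simp [add_comm]
  | hr a => rw [pushBracket_inr_left, pushBracket_inr_right]; simp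
  | hadd x x' hx hx' =>
    rw [map_add, map_add, LinearMap.add_apply, hx, hx', map_add]
    abel
  | hmul x x' hx hx' =>
    rw [pushBracket_mul_right, pushBracket_mul_left, hx, hx', map_add, comm_mul, comm_mul]
    simp [add_comm]

theorem pushBracket_inl_right {b : A} (hb : b ∈ B) (x : Amalgam j j') :
    pushBracket hB hbr x (inl j j' b) = 0 := by
  induction x using Amalgam.induction with
  | hl a => rw [pushBracket_inl_inl, hbr.vanish_right b hb, map_zero]
  | hr a => exact pushBracket_inr_left hB hbr a _
  | hadd x x' hx hx' => rw [map_add, LinearMap.add_apply, hx, hx', add_zero]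
  | hmul x x' hx hx' => rw [pushBracket_mul_left, hx, hx', mul_zero, zero_mul, add_zero]

/-- Trilinear cyclic maps that are derivations in the last argument and vanish on `A'` are zero
as soon as they vanish on `A`. -/
theorem triple_eq_zero {T : Amalgam j j' → Amalgam j j' → Amalgam j j' →
      (Amalgam j j' ⊗[k] Amalgam j j') ⊗[k] Amalgam j j'}
    (hcyc : ∀ x y z, tau k _ (T y z x) = T x y z)
    (hadd : ∀ x y z z', T x y (z + z') = T x y z + T x y z')
    (hmul : ∀ x y z z', T x y (z * z') =
      (z ⊗ₜ[k] 1 ⊗ₜ[k] 1) * T x y z' + T x y z * (1 ⊗ₜ[k] 1 ⊗ₜ[k] z'))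
    (hr : ∀ x y b, T x y (inr j j' b) = 0)
    (hl : ∀ a b c, T (inl j j' a) (inl j j' b) (inl j j' c) = 0) (x y z : Amalgam j j') :
    T x y z = 0 := by
  have step : ∀ x y, (∀ a, T x y (inl j j' a) = 0) → ∀ z, T x y z = 0 := fun x y h z => by
    induction z using Amalgam.induction with
    | hl a => exact h a
    | hr b => exact hr x y b
    | hadd z z' hz hz' => rw [hadd, hz, hz', add_zero]
    | hmul z z' hz hz' => rw [hmul, hz, hz', mul_zero, zero_mul, add_zero]
  have rot : ∀ x y z, T x y z = 0 → T y z x = 0 := fun x y z h => by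
    rw [← hcyc y z x, ← hcyc z x y, h, map_zero, map_zero]
  have h1 := fun a b => step _ _ (hl a b)
  -- The entries from `A` are freed one at a time: two of them remain in `h1`, one in `h2`, none in
  -- the last line. Each rotation brings an entry from `A` to the last position.
  have h2 := fun b z => step (inl j j' b) z fun a => rot _ _ _ (h1 a b z)
  exact step x y (fun b => rot _ _ _ (h2 b x y)) z

end Amalgam

/-! ### Brackets and derivations on the extension algebra -/

theorem idem_mem_idemSubalgebra {k : Type*} [Field k] {A : Type*} [Ring A] [Algebra k A]
    {I : Type*} {e : I → A} (s : I) : e s ∈ idemSubalgebra k e :=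
  Algebra.subset_adjoin ⟨s, rfl⟩

section Ext

variable {k : Type*} [Field k] {A : Type*} [Ring A] [Algebra k A] {I : Type*} [Fintype I]
  {e : I → A} (he : CompleteOrthogonalIdempotents e) {p q : I} (hpq : p ≠ q)

variable (k) in
theorem toExt_left_idem :
    toExt k he hpq (e p) = Amalgam.inr _ _ (Matrix.single 0 0 1, 0) := by
  have h := Amalgam.inl_eq_inr (baseMap k he hpq) (matMap k) (1, 0, 0)
  have h1 : baseMap k he hpq (1, 0, 0) = e p := by simp [baseMap]
  have h2 : matMap k (1, 0, 0) = (Matrix.single 0 0 1, 0) := by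
    ext i j
    · fin_cases i <;> fin_cases j <;> simp [matMap, Matrix.diagonal]
    · simp [matMap]
  rwa [h1, h2] at h

variable (k) in
theorem toExt_right_idem :
    toExt k he hpq (e q) = Amalgam.inr _ _ (Matrix.single 1 1 1, 0) := by
  have h := Amalgam.inl_eq_inr (baseMap k he hpq) (matMap k) (0, 1, 0)
  have h1 : baseMap k he hpq (0, 1, 0) = e q := by simp [baseMap]
  have h2 : matMap k (0, 1, 0) = (Matrix.single 1 1 1, 0) := by
    ext i j
    · fin_cases i <;> fin_cases j <;> simp [matMap, Matrix.diagonal]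
    · simp [matMap]
  rwa [h1, h2] at h

variable (k) in
theorem toExt_compl :
    toExt k he hpq (1 - e p - e q) = Amalgam.inr _ _ (0, 1) := by
  have h := Amalgam.inl_eq_inr (baseMap k he hpq) (matMap k) (0, 0, 1)
  have h1 : baseMap k he hpq (0, 0, 1) = 1 - e p - e q := by simp [baseMap]
  have h2 : matMap k (0, 0, 1) = (0, 1) := by
    ext i j
    · fin_cases i <;> fin_cases j <;> simp [matMap, Matrix.diagonal]
    · simp [matMap]
  rwa [h1, h2] at h

variable (k) in
theorem unit12_mul_unit21 : unit12 k he hpq * unit21 k he hpq = toExt k he hpq (e p) := by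
  rw [toExt_left_idem, unit12, unit21, ← map_mul]; simp

variable (k) in
theorem unit21_mul_unit12 : unit21 k he hpq * unit12 k he hpq = toExt k he hpq (e q) := by
  rw [toExt_right_idem, unit12, unit21, ← map_mul]; simp

variable (k) in
theorem isUnitPair : IsUnitPair (unit21 k he hpq) (unit12 k he hpq) := by
  constructor <;> simp only [unit12, unit21, ← map_mul]
  · exact (congrArg _ (by simp)).trans (map_zero _)
  · exact (congrArg _ (by simp)).trans (map_zero _)
  · simp
  · simp

variable (k) in
theorem unit21_mul_eps : unit21 k he hpq * eps k he hpq = unit21 k he hpq := by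
  rw [eps, mul_sub, mul_one, ← unit21_mul_unit12, ← mul_assoc, (isUnitPair k he hpq).uu, zero_mul,
    sub_zero]

variable (k) in
theorem eps_mul_unit21 : eps k he hpq * unit21 k he hpq = 0 := by
  rw [eps, sub_mul, one_mul, ← unit21_mul_unit12, mul_assoc, (isUnitPair k he hpq).uvu, sub_self]

variable (k) in
theorem eps_mul_unit12 : eps k he hpq * unit12 k he hpq = unit12 k he hpq := by
  rw [eps, sub_mul, one_mul, ← unit21_mul_unit12, mul_assoc, (isUnitPair k he hpq).vv, mul_zero,
    sub_zero]

variable (k) in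
theorem unit12_mul_eps : unit12 k he hpq * eps k he hpq = 0 := by
  rw [eps, mul_sub, mul_one, ← unit21_mul_unit12, (isUnitPair k he hpq).vuv, sub_self]

theorem eps_mul_toExt {s : I} (hs : s ≠ q) :
    eps k he hpq * toExt k he hpq (e s) = toExt k he hpq (e s) := by
  rw [eps, sub_mul, one_mul, ← map_mul, he.ortho hs.symm, map_zero, sub_zero]

theorem toExt_mul_eps {s : I} (hs : s ≠ q) :
    toExt k he hpq (e s) * eps k he hpq = toExt k he hpq (e s) := by
  rw [eps, mul_sub, mul_one, ← map_mul, he.ortho hs, map_zero, sub_zero]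

variable (k) in
/-- The subalgebra generated by the idempotents `e_s` and the matrix units. -/
def extBase : Subalgebra k (ExtAlgebra k he hpq) :=
  Algebra.adjoin k (Set.range (fun s => toExt k he hpq (e s)) ∪
    Set.range (Amalgam.inr (baseMap k he hpq) (matMap k)))

theorem toExt_mem_extBase (s : I) : toExt k he hpq (e s) ∈ extBase k he hpq :=
  Algebra.subset_adjoin (Or.inl ⟨s, rfl⟩)

theorem inr_mem_extBase (m : Matrix (Fin 2) (Fin 2) k × k) :
    Amalgam.inr (baseMap k he hpq) (matMap k) m ∈ extBase k he hpq :=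
  Algebra.subset_adjoin (Or.inr ⟨m, rfl⟩)

variable (k) in
theorem unit12_mem_extBase : unit12 k he hpq ∈ extBase k he hpq := inr_mem_extBase _ _ _

variable (k) in
theorem unit21_mem_extBase : unit21 k he hpq ∈ extBase k he hpq := inr_mem_extBase _ _ _

variable (k) in
theorem eps_mem_extBase : eps k he hpq ∈ extBase k he hpq :=
  sub_mem (one_mem _) (toExt_mem_extBase _ _ _)

/-- The extension of a double bracket to the extension algebra. -/
abbrev extBracket {br : A →ₗ[k] A →ₗ[k] A ⊗[k] A}
    (hbr : IsDoubleBracket (idemSubalgebra k e) br) :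
    ExtAlgebra k he hpq →ₗ[k] ExtAlgebra k he hpq →ₗ[k]
      ExtAlgebra k he hpq ⊗[k] ExtAlgebra k he hpq :=
  Amalgam.pushBracket (j' := matMap k) (baseMap_mem he hpq) hbr

theorem isDoubleBracket_extBracket {br : A →ₗ[k] A →ₗ[k] A ⊗[k] A}
    (hbr : IsDoubleBracket (idemSubalgebra k e) br) :
    IsDoubleBracket (extBase k he hpq) (extBracket he hpq hbr) := by
  refine isDoubleBracket_adjoin (Amalgam.pushBracket_antisymm _ hbr)
    (Amalgam.pushBracket_mul_right _ hbr) ?_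
  rintro _ (⟨s, rfl⟩ | ⟨m, rfl⟩) a
  · exact Amalgam.pushBracket_inl_right _ hbr (idem_mem_idemSubalgebra s) a
  · exact Amalgam.pushBracket_inr_right _ hbr a m

/-- `w ↦ w' x ⊗ y w''`. -/
def innerMul {R : Type*} [Ring R] [Algebra k R] (x y : R) : R ⊗[k] R →ₗ[k] R ⊗[k] R :=
  TensorProduct.map (LinearMap.mulRight k x) (LinearMap.mulLeft k y)

theorem innerMul_tmul {R : Type*} [Ring R] [Algebra k R] (x y a b : R) :
    innerMul x y (a ⊗ₜ[k] b) = (a * x) ⊗ₜ[k] (y * b) := rfl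

theorem innerMul_eq {R : Type*} [Ring R] [Algebra k R] (x y : R) (w : R ⊗[k] R) :
    innerMul x y w = (1 ⊗ₜ[k] y) * w * (x ⊗ₜ[k] 1) := by
  induction w using TensorProduct.induction_on with
  | zero => simp
  | add w w' h h' => rw [map_add, h, h', mul_add, add_mul]
  | tmul a b => simp [innerMul_tmul]

/-- Inner multiplications commute with the outer bimodule structure, so composing a double
derivation with `innerMul` gives a double derivation again. This makes `extTraceGauge` a derivation
on all of Ā. -/
theorem innerMul_leibniz {R : Type*} [Ring R] [Algebra k R] (x y a b : R) (w w' : R ⊗[k] R) :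
    innerMul x y ((a ⊗ₜ[k] 1) * w + w' * (1 ⊗ₜ[k] b)) =
      (a ⊗ₜ[k] 1) * innerMul x y w + innerMul x y w' * (1 ⊗ₜ[k] b) := by
  have h1 : ∀ w : R ⊗[k] R, innerMul x y ((a ⊗ₜ[k] 1) * w) = (a ⊗ₜ[k] 1) * innerMul x y w := by
    intro w
    induction w using TensorProduct.induction_on with
    | zero => simp
    | add w w' h h' => simp only [mul_add, map_add, h, h']
    | tmul c d => simp [innerMul_tmul, mul_assoc]
  have h2 : ∀ w : R ⊗[k] R, innerMul x y (w * (1 ⊗ₜ[k] b)) = innerMul x y w * (1 ⊗ₜ[k] b) := by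
    intro w
    induction w using TensorProduct.induction_on with
    | zero => simp
    | add w w' h h' => simp only [add_mul, map_add, h, h']
    | tmul c d => simp [innerMul_tmul, mul_assoc]
  rw [map_add, h1, h2]

variable (k) in
/-- The derivation of the extension algebra that restricts to `Tr(E_s)` on the fusion algebra. -/
def extTraceGauge (s : I) : ExtAlgebra k he hpq →ₗ[k] ExtAlgebra k he hpq ⊗[k] ExtAlgebra k he hpq :=
  (innerMul (eps k he hpq) (eps k he hpq) + innerMul (unit21 k he hpq) (unit12 k he hpq)) ∘ₗ
    Amalgam.pushDer (baseMap_mem he hpq) (gauge_isDoubleDerivation (k := k) he s)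

/-- On `A` the gauge element is the inner derivation of `e_s ⊗ e_s`, and an inner multiplication
only changes this tensor. The formula is confined to the image of `A`: the trace kills the matrix
units, the inner derivation in general does not. -/
theorem extTraceGauge_toExt (s : I) (a : A) : extTraceGauge k he hpq s (toExt k he hpq a) =
    innerDer ((toExt k he hpq (e s) * eps k he hpq) ⊗ₜ[k] (eps k he hpq * toExt k he hpq (e s))
      + (toExt k he hpq (e s) * unit21 k he hpq) ⊗ₜ[k] (unit12 k he hpq * toExt k he hpq (e s)))
      (toExt k he hpq a) := by
  have h : Amalgam.pushDer (baseMap_mem he hpq) (gauge_isDoubleDerivation (k := k) he s)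
      (toExt k he hpq a) = Amalgam.inlTensor (baseMap k he hpq) (matMap k) (gauge k (e s) a) :=
    Amalgam.pushDer_inl _ _ a
  rw [extTraceGauge, LinearMap.comp_apply, h, gauge_apply, map_sub, Amalgam.inlTensor_tmul,
    Amalgam.inlTensor_tmul, innerDer_apply]
  simp only [← toExt.eq_def, map_mul, LinearMap.add_apply, map_sub, innerMul_tmul, mul_add,
    add_mul, Algebra.TensorProduct.tmul_mul_tmul, one_mul, mul_one, mul_assoc]

theorem isDoubleDerivation_pushDer_gauge (s : I) : IsDoubleDerivation (extBase k he hpq)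
    (Amalgam.pushDer (j' := matMap k) (baseMap_mem he hpq)
      (gauge_isDoubleDerivation (k := k) he s)) := by
  refine isDoubleDerivation_adjoin (Amalgam.pushDer_mul _ _) ?_
  rintro _ (⟨t, rfl⟩ | ⟨m, rfl⟩)
  · rw [toExt, Amalgam.pushDer_inl,
      (gauge_isDoubleDerivation he s).vanish _ (idem_mem_idemSubalgebra t), map_zero]
  · rw [Amalgam.pushDer_inr]

theorem isDoubleDerivation_extTraceGauge (s : I) :
    IsDoubleDerivation (extBase k he hpq) (extTraceGauge k he hpq s) := by
  refine ⟨fun a b => ?_, fun b hb => ?_⟩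
  · simp only [extTraceGauge, LinearMap.comp_apply, LinearMap.add_apply, Amalgam.pushDer_mul,
      innerMul_leibniz, mul_add, add_mul]
    abel
  · rw [extTraceGauge, LinearMap.comp_apply,
      (isDoubleDerivation_pushDer_gauge he hpq s).vanish b hb, map_zero]

/-- Only the untwisted summand survives, because `e_p e₂₁ = 0`. -/
theorem extTraceGauge_left (a : A) : extTraceGauge k he hpq p (toExt k he hpq a) =
    innerDer ((unit12 k he hpq * unit21 k he hpq) ⊗ₜ[k] (unit12 k he hpq * unit21 k he hpq))
      (toExt k he hpq a) := by
  rw [extTraceGauge_toExt, eps_mul_toExt he hpq hpq, toExt_mul_eps he hpq hpq,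
    ← unit12_mul_unit21, mul_assoc, (isUnitPair k he hpq).uu, mul_zero, TensorProduct.zero_tmul,
    add_zero]

/-- Only the twisted summand survives, because `ε e_q = 0`. -/
theorem extTraceGauge_right (a : A) : extTraceGauge k he hpq q (toExt k he hpq a) =
    innerDer (unit21 k he hpq ⊗ₜ[k] unit12 k he hpq) (toExt k he hpq a) := by
  rw [extTraceGauge_toExt, ← unit21_mul_unit12, ← mul_assoc (eps k he hpq), eps_mul_unit21,
    zero_mul, TensorProduct.tmul_zero, zero_add, mul_assoc, (isUnitPair k he hpq).uvu,
    (isUnitPair k he hpq).vuv]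

/-- The fusion bracket on the extension algebra. -/
def extFusionBracket {br : A →ₗ[k] A →ₗ[k] A ⊗[k] A}
    (hbr : IsDoubleBracket (idemSubalgebra k e) br) :
    ExtAlgebra k he hpq →ₗ[k] ExtAlgebra k he hpq →ₗ[k]
      ExtAlgebra k he hpq ⊗[k] ExtAlgebra k he hpq :=
  extBracket he hpq hbr
    + (-(1 / 2) : k) • bivectorBracket (extTraceGauge k he hpq p) (extTraceGauge k he hpq q)

theorem isDoubleBracket_extFusionBracket {br : A →ₗ[k] A →ₗ[k] A ⊗[k] A}
    (hbr : IsDoubleBracket (idemSubalgebra k e) br) :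
    IsDoubleBracket (extBase k he hpq) (extFusionBracket he hpq hbr) :=
  (isDoubleBracket_extBracket he hpq hbr).add
    ((isDoubleBracket_bivectorBracket (isDoubleDerivation_extTraceGauge he hpq p)
      (isDoubleDerivation_extTraceGauge he hpq q)).smul _)

end Ext

section Ext

variable {k : Type*} [Field k] {A : Type*} [Ring A] [Algebra k A] {I : Type*} [Fintype I]
  {e : I → A} (he : CompleteOrthogonalIdempotents e) {p q : I} (hpq : p ≠ q)

theorem inr_eq (m : Matrix (Fin 2) (Fin 2) k × k) :
    Amalgam.inr (baseMap k he hpq) (matMap k) m =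
      m.1 0 0 • (unit12 k he hpq * unit21 k he hpq) + m.1 0 1 • unit12 k he hpq
      + m.1 1 0 • unit21 k he hpq + m.1 1 1 • (unit21 k he hpq * unit12 k he hpq)
      + m.2 • toExt k he hpq (1 - e p - e q) := by
  simp only [unit12, unit21, toExt_compl, ← map_mul, ← map_smul, ← map_add]
  congr 1
  ext i j
  · fin_cases i <;> fin_cases j <;> simp
  · simp

variable {he hpq} in
/-- A double derivation that vanishes on the matrix units and the idempotents `e_s` is linear over
the subalgebra they generate. -/
theorem isDoubleDerivation_extBase
    {δ : ExtAlgebra k he hpq →ₗ[k] ExtAlgebra k he hpq ⊗[k] ExtAlgebra k he hpq}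
    (hl : ∀ a b, δ (a * b) = (a ⊗ₜ[k] 1) * δ b + δ a * (1 ⊗ₜ[k] b))
    (hu : δ (unit21 k he hpq) = 0) (hv : δ (unit12 k he hpq) = 0)
    (hs : ∀ s, δ (toExt k he hpq (e s)) = 0) : IsDoubleDerivation (extBase k he hpq) δ := by
  refine isDoubleDerivation_adjoin hl ?_
  rintro _ (⟨s, rfl⟩ | ⟨m, rfl⟩)
  · exact hs s
  · have h1 : δ 1 = 0 :=
      (isDoubleDerivation_adjoin (S := ∅) hl (by simp)).vanish 1 (one_mem _)
    rw [inr_eq]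
    simp only [map_add, map_sub, map_smul, map_one, hl, hu, hv, hs, h1, mul_zero, zero_mul,
      sub_zero, add_zero, smul_zero]

theorem toExt_mul_unit12 {s : I} (hs : s ≠ p) :
    toExt k he hpq (e s) * unit12 k he hpq = 0 := by
  rw [← (isUnitPair k he hpq).vuv, ← mul_assoc (unit12 k he hpq), unit12_mul_unit21, ← mul_assoc,
    ← map_mul, he.ortho hs, map_zero, zero_mul]

theorem toExt_mul_unit21 {s : I} (hs : s ≠ q) :
    toExt k he hpq (e s) * unit21 k he hpq = 0 := by
  rw [← (isUnitPair k he hpq).uvu, ← mul_assoc (unit21 k he hpq), unit21_mul_unit12, ← mul_assoc,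
    ← map_mul, he.ortho hs, map_zero, zero_mul]

theorem unit12_mul_toExt {s : I} (hs : s ≠ q) :
    unit12 k he hpq * toExt k he hpq (e s) = 0 := by
  rw [← (isUnitPair k he hpq).vuv, unit21_mul_unit12, mul_assoc, ← map_mul, he.ortho hs.symm,
    map_zero, mul_zero]

theorem unit21_mul_toExt {s : I} (hs : s ≠ p) :
    unit21 k he hpq * toExt k he hpq (e s) = 0 := by
  rw [← (isUnitPair k he hpq).uvu, unit12_mul_unit21, mul_assoc, ← map_mul, he.ortho hs.symm,
    map_zero, mul_zero]

/-- On each matrix unit the terms coming from `vu ⊗ vu` cancel those coming from `u ⊗ v`; neither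
inner derivation vanishes there alone. Since `e_p = vu` and `e_q = uv`, the Leibniz rule takes care
of these two idempotents, and the others are orthogonal to `u` and `v` on both sides. -/
theorem isDoubleDerivation_unitDer : IsDoubleDerivation (extBase k he hpq)
    (unitDer k (unit21 k he hpq) (unit12 k he hpq)) := by
  have h := isUnitPair k he hpq
  have h1 : ∀ y, unit12 k he hpq * (unit12 k he hpq * y) = 0 := fun y => by
    rw [← mul_assoc, h.vv, zero_mul]
  have hu : unitDer k (unit21 k he hpq) (unit12 k he hpq) (unit21 k he hpq) = 0 := by
    simp [unitDer, innerDer_apply, mul_add, add_mul, mul_assoc, h.uu, h.uvu]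
  have hv : unitDer k (unit21 k he hpq) (unit12 k he hpq) (unit12 k he hpq) = 0 := by
    simp [unitDer, innerDer_apply, mul_add, add_mul, mul_assoc, h.vv, h.vuv, h1]
  refine isDoubleDerivation_extBase (innerDer_mul _) hu hv fun s => ?_
  by_cases hp : s = p
  · rw [hp, ← unit12_mul_unit21, unitDer, innerDer_mul, ← unitDer, hu, hv, mul_zero, zero_mul,
      add_zero]
  by_cases hq : s = q
  · rw [hq, ← unit21_mul_unit12, unitDer, innerDer_mul, ← unitDer, hu, hv, mul_zero, zero_mul,
      add_zero]
  simp [unitDer, innerDer_apply, mul_add, add_mul, mul_assoc, unit21_mul_toExt he hpq hp,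
    unit12_mul_toExt he hpq hq, toExt_mul_unit21 he hpq hq, ← mul_assoc (toExt k he hpq (e s)),
    toExt_mul_unit12 he hpq hp]

theorem isDoubleDerivation_gauge_toExt {s : I} (hp : s ≠ p) (hq : s ≠ q) :
    IsDoubleDerivation (extBase k he hpq) (gauge k (toExt k he hpq (e s))) := by
  refine isDoubleDerivation_extBase (fun a b => ?_) ?_ ?_ fun t => ?_
  · rw [gauge_eq_innerDer, innerDer_mul]
  · simp [gauge_apply, unit21_mul_toExt he hpq hp, toExt_mul_unit21 he hpq hq]
  · simp [gauge_apply, unit12_mul_toExt he hpq hq, toExt_mul_unit12 he hpq hp]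
  · rw [gauge_apply, ← map_mul, ← map_mul]
    by_cases h : t = s
    · rw [h, (he.idem s).eq, sub_self]
    · rw [he.ortho h, he.ortho (Ne.symm h)]; simp

variable (k) in
/-- The gauge elements of the fusion algebra, extended to the extension algebra. -/
def extGauge [DecidableEq I] (s : {s : I // s ≠ q}) :
    ExtAlgebra k he hpq →ₗ[k] ExtAlgebra k he hpq ⊗[k] ExtAlgebra k he hpq :=
  if s.1 = p then unitDer k (unit21 k he hpq) (unit12 k he hpq)
  else gauge k (toExt k he hpq (e s))

theorem isDoubleDerivation_extGauge [DecidableEq I] (s : {s : I // s ≠ q}) :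
    IsDoubleDerivation (extBase k he hpq) (extGauge k he hpq s) := by
  unfold extGauge
  split_ifs with h
  · exact isDoubleDerivation_unitDer he hpq
  · exact isDoubleDerivation_gauge_toExt he hpq h s.2

theorem bivectorBracket_extTraceGauge (a b : A) :
    bivectorBracket (extTraceGauge k he hpq p) (extTraceGauge k he hpq q)
        (toExt k he hpq a) (toExt k he hpq b) =
      unitBracket k (unit21 k he hpq) (unit12 k he hpq) (toExt k he hpq a) (toExt k he hpq b) := by
  simp only [unitBracket, bivectorBracket_apply, extTraceGauge_left, extTraceGauge_right]

variable {br : A →ₗ[k] A →ₗ[k] A ⊗[k] A} (hbr : IsDoubleBracket (idemSubalgebra k e) br)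

theorem extBracket_toExt (a b : A) :
    TensorProduct.map (toExt k he hpq).toLinearMap (toExt k he hpq).toLinearMap (br a b) =
      extBracket he hpq hbr (toExt k he hpq a) (toExt k he hpq b) :=
  (Amalgam.pushBracket_inl_inl (baseMap_mem he hpq) hbr a b).symm

theorem tripleBracket_extBracket (hqp : IsQuasiPoisson e br) (a b c : A) :
    tripleBracket (extBracket he hpq hbr) (toExt k he hpq a) (toExt k he hpq b)
      (toExt k he hpq c) = (1 / 4 : k) • ∑ s, contract₃ (gauge k (toExt k he hpq (e s))
        (toExt k he hpq a)) (gauge k (toExt k he hpq (e s)) (toExt k he hpq b))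
        (gauge k (toExt k he hpq (e s)) (toExt k he hpq c)) := by
  have h := map_tripleBracket (f := (toExt k he hpq).toLinearMap) (extBracket_toExt he hpq hbr)
    a b c
  have hg : ∀ (x a : A), TensorProduct.map (toExt k he hpq).toLinearMap
      (toExt k he hpq).toLinearMap (gauge k x a) =
      gauge k (toExt k he hpq x) (toExt k he hpq a) := fun x a => by simp [gauge_apply]
  refine h.symm.trans ?_
  rw [hqp a b c, map_smul, map_sum]
  refine congrArg _ (Finset.sum_congr rfl fun s _ => ?_)
  rw [quasiPoisson_term_eq_contract₃ (he.idem s), map_contract₃ _ (by simp), hg, hg, hg]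

/-- Bookkeeping for fusion: the index `q` disappears, the term at `p` becomes that of `unitDer`, and
the others are unchanged. The correction is the quadratic part found in
`IsUnitPair.triple_unitBracket`. -/
theorem sum_contract₃_extGauge [DecidableEq I] (a b c : ExtAlgebra k he hpq) :
    ∑ s, contract₃ (extGauge k he hpq s a) (extGauge k he hpq s b) (extGauge k he hpq s c) =
      (∑ s, contract₃ (gauge k (toExt k he hpq (e s)) a) (gauge k (toExt k he hpq (e s)) b)
        (gauge k (toExt k he hpq (e s)) c))
      + (contract₃ (unitDer k (unit21 k he hpq) (unit12 k he hpq) a)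
          (unitDer k (unit21 k he hpq) (unit12 k he hpq) b)
          (unitDer k (unit21 k he hpq) (unit12 k he hpq) c)
        - contract₃ (gauge k (toExt k he hpq (e p)) a) (gauge k (toExt k he hpq (e p)) b)
          (gauge k (toExt k he hpq (e p)) c)
        - contract₃ (gauge k (toExt k he hpq (e q)) a) (gauge k (toExt k he hpq (e q)) b)
          (gauge k (toExt k he hpq (e q)) c)) := by
  set g : I → (ExtAlgebra k he hpq ⊗[k] ExtAlgebra k he hpq) ⊗[k] ExtAlgebra k he hpq :=
    fun s => contract₃ (gauge k (toExt k he hpq (e s)) a) (gauge k (toExt k he hpq (e s)) b)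
        (gauge k (toExt k he hpq (e s)) c) with hg
  set f : {s : I // s ≠ q} →
      (ExtAlgebra k he hpq ⊗[k] ExtAlgebra k he hpq) ⊗[k] ExtAlgebra k he hpq :=
    fun s => contract₃ (extGauge k he hpq s a) (extGauge k he hpq s b)
      (extGauge k he hpq s c) with hf
  have hfg : ∀ s : {s : I // s ≠ q}, s ≠ ⟨p, hpq⟩ → f s = g s := fun s hs => by
    have : s.1 ≠ p := fun h => hs (Subtype.ext h)
    simp only [hf, hg, extGauge, if_neg this]
  have hfp : f ⟨p, hpq⟩ = contract₃ (unitDer k (unit21 k he hpq) (unit12 k he hpq) a)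
      (unitDer k (unit21 k he hpq) (unit12 k he hpq) b)
      (unitDer k (unit21 k he hpq) (unit12 k he hpq) c) := by
    simp only [hf, extGauge, if_true]
  rw [Fintype.sum_eq_add_sum_subtype_ne g q,
    ← Finset.add_sum_erase _ f (Finset.mem_univ (⟨p, hpq⟩ : {s : I // s ≠ q})),
    ← Finset.add_sum_erase _ (fun s : {s : I // s ≠ q} => g s)
      (Finset.mem_univ (⟨p, hpq⟩ : {s : I // s ≠ q})),
    Finset.sum_congr rfl fun s hs => hfg s (Finset.ne_of_mem_erase hs), hfp]
  abel

theorem tripleBracket_extFusionBracket_toExt [CharZero k] [DecidableEq I]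
    (hqp : IsQuasiPoisson e br) (a b c : A) :
    tripleBracket (extFusionBracket he hpq hbr) (toExt k he hpq a) (toExt k he hpq b)
      (toExt k he hpq c) = (1 / 4 : k) • ∑ s, contract₃ (extGauge k he hpq s (toExt k he hpq a))
        (extGauge k he hpq s (toExt k he hpq b)) (extGauge k he hpq s (toExt k he hpq c)) := by
  -- The factor `-½` of the bivector is squared in the quadratic part, which produces the `¼` of the
  -- quasi-Poisson condition.
  have h4 : (-(1 / 2)) * (-(1 / 2)) = (1 / 4 : k) := by norm_num
  rw [sum_contract₃_extGauge, smul_add, ← tripleBracket_extBracket he hpq hbr hqp, ← h4,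
    ← unit12_mul_unit21, ← unit21_mul_unit12, extFusionBracket]
  refine (isUnitPair k he hpq).tripleBracket_add_smul (S := Set.range (toExt k he hpq))
    (isDoubleBracket_extBracket he hpq hbr)
    (isDoubleBracket_bivectorBracket (isDoubleDerivation_extTraceGauge he hpq p)
      (isDoubleDerivation_extTraceGauge he hpq q))
    (unit21_mem_extBase k he hpq) (unit12_mem_extBase k he hpq) ?_ ?_ _ ⟨a, rfl⟩ ⟨b, rfl⟩ ⟨c, rfl⟩
  · rintro _ ⟨a, rfl⟩ _ ⟨b, rfl⟩
    exact bivectorBracket_extTraceGauge he hpq a b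
  · rintro _ ⟨a, rfl⟩ _ ⟨b, rfl⟩ _ ⟨c, rfl⟩
    rw [← extBracket_toExt]
    induction br b c using TensorProduct.induction_on with
    | zero => simp
    | add x y hx hy => rw [map_add, map_add, map_add, hx, hy]
    | tmul x y =>
      rw [TensorProduct.map_tmul, brLeft_tmul, brLeft_tmul]
      exact congrArg (· ⊗ₜ[k] _) (bivectorBracket_extTraceGauge he hpq a x)

/-- The fusion bracket on the extension algebra is quasi-Poisson for the fused gauge elements. -/
theorem tripleBracket_extFusionBracket [CharZero k] [DecidableEq I]
    (hqp : IsQuasiPoisson e br) (a b c : ExtAlgebra k he hpq) :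
    tripleBracket (extFusionBracket he hpq hbr) a b c = (1 / 4 : k) •
      ∑ s, contract₃ (extGauge k he hpq s a) (extGauge k he hpq s b) (extGauge k he hpq s c) := by
  have hQ := isDoubleBracket_extFusionBracket he hpq hbr
  rw [← sub_eq_zero]
  -- The difference of the two sides is cyclic, a derivation in the last argument and zero on the
  -- matrix summand, so elements of `A` suffice.
  refine Amalgam.triple_eq_zero (T := fun a b c => tripleBracket (extFusionBracket he hpq hbr) a b c
    - (1 / 4 : k) • ∑ s, contract₃ (extGauge k he hpq s a) (extGauge k he hpq s b)
      (extGauge k he hpq s c)) ?_ ?_ ?_ ?_ ?_ a b c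
  · intro x y z
    rw [map_sub, map_smul, map_sum, tau_tripleBracket]
    simp only [tau_contract₃]
  · intro x y z z'
    have h1 : tripleBracket (extFusionBracket he hpq hbr) x y (z + z') =
        tripleBracket (extFusionBracket he hpq hbr) x y z
          + tripleBracket (extFusionBracket he hpq hbr) x y z' := by
      simp only [tripleBracket, brLeft, map_add, LinearMap.add_apply, LinearMap.rTensor_add]
      abel
    simp only [h1, map_add, Finset.sum_add_distrib, smul_add]
    abel
  · intro x y z z'
    simp only [hQ.tripleBracket_mul,
      contract₃_leibniz (isDoubleDerivation_extGauge he hpq _).leibniz, Finset.sum_add_distrib,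
      smul_add, mul_sub, sub_mul, Finset.mul_sum, Finset.sum_mul, mul_smul_comm, smul_mul_assoc]
    abel
  · intro x y m
    have hm := inr_mem_extBase he hpq m
    have h1 : extFusionBracket he hpq hbr (Amalgam.inr (baseMap k he hpq) (matMap k) m) = 0 :=
      LinearMap.ext (hQ.vanish_left _ hm)
    simp [tripleBracket, brLeft, hQ.vanish_right _ hm, h1,
      (isDoubleDerivation_extGauge he hpq _).vanish _ hm]
  · intro a b c
    exact sub_eq_zero.2 (tripleBracket_extFusionBracket_toExt he hpq hbr hqp a b c)

end Ext

/-! ### Corners -/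

section Corner

variable {k : Type*} [Field k] {R : Type*} [Ring R] [Algebra k R] {x : R}
  (hx : IsIdempotentElem x)

theorem cornerVal_mul (a b : hx.Corner) :
    cornerVal (k := k) hx (a * b) = cornerVal (k := k) hx a * cornerVal (k := k) hx b := rfl

theorem cornerVal_one : cornerVal (k := k) hx 1 = x := rfl

theorem cornerVal_cornerProj (a : R) :
    cornerVal (k := k) hx (cornerProj (k := k) hx a) = x * a * x := rfl

theorem cornerVal_injective : Function.Injective (cornerVal (k := k) hx) :=
  fun _ _ h => Subtype.ext h

theorem mul_cornerVal (a : hx.Corner) :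
    x * cornerVal (k := k) hx a = cornerVal (k := k) hx a :=
  ((Subsemigroup.mem_corner_iff hx).1 a.2).1

theorem cornerVal_mul_self (a : hx.Corner) :
    cornerVal (k := k) hx a * x = cornerVal (k := k) hx a :=
  ((Subsemigroup.mem_corner_iff hx).1 a.2).2

theorem cornerProj_cornerVal (a : hx.Corner) :
    cornerProj (k := k) hx (cornerVal (k := k) hx a) = a :=
  cornerVal_injective (k := k) hx (by
    rw [cornerVal_cornerProj, mul_cornerVal, cornerVal_mul_self])

theorem cornerProj_comp_cornerVal : cornerProj (k := k) hx ∘ₗ cornerVal hx = LinearMap.id :=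
  LinearMap.ext (cornerProj_cornerVal hx)

/-- The projection onto the corner is a linear retraction of the inclusion, and tensoring preserves
retractions. Identities in tensor powers of `A^f` can thus be checked in those of Ā. -/
theorem map_cornerVal_injective :
    Function.Injective (TensorProduct.map (cornerVal (k := k) hx) (cornerVal (k := k) hx)) := by
  refine Function.LeftInverse.injective (g := TensorProduct.map (cornerProj hx) (cornerProj hx))
    fun w => ?_
  rw [← LinearMap.comp_apply, ← TensorProduct.map_comp, cornerProj_comp_cornerVal,
    TensorProduct.map_id, LinearMap.id_apply]

theorem map_map_cornerVal_injective : Function.Injective (TensorProduct.map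
    (TensorProduct.map (cornerVal (k := k) hx) (cornerVal (k := k) hx)) (cornerVal hx)) := by
  refine Function.LeftInverse.injective (g := TensorProduct.map
    (TensorProduct.map (cornerProj hx) (cornerProj hx)) (cornerProj hx)) fun w => ?_
  rw [← LinearMap.comp_apply, ← TensorProduct.map_comp, ← TensorProduct.map_comp,
    cornerProj_comp_cornerVal, TensorProduct.map_id, TensorProduct.map_id, LinearMap.id_apply]

theorem map_cornerVal_left_mul (a : hx.Corner) (w : hx.Corner ⊗[k] hx.Corner) :
    TensorProduct.map (cornerVal (k := k) hx) (cornerVal hx) ((a ⊗ₜ[k] 1) * w) =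
      (cornerVal (k := k) hx a ⊗ₜ[k] 1) *
        TensorProduct.map (cornerVal (k := k) hx) (cornerVal hx) w := by
  induction w using TensorProduct.induction_on with
  | zero => simp
  | add w w' h h' => simp only [mul_add, map_add, h, h']
  | tmul b c => simp [cornerVal_mul]

theorem map_cornerVal_mul_right (a : hx.Corner) (w : hx.Corner ⊗[k] hx.Corner) :
    TensorProduct.map (cornerVal (k := k) hx) (cornerVal hx) (w * (1 ⊗ₜ[k] a)) =
      TensorProduct.map (cornerVal (k := k) hx) (cornerVal hx) w *
        (1 ⊗ₜ[k] cornerVal (k := k) hx a) := by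
  induction w using TensorProduct.induction_on with
  | zero => simp
  | add w w' h h' => simp only [add_mul, map_add, h, h']
  | tmul b c => simp [cornerVal_mul]

/-- A family of linear maps on a corner that comes from a double bracket on the algebra is a double
bracket. -/
theorem isDoubleBracket_corner {B : Subalgebra k R} {br : R →ₗ[k] R →ₗ[k] R ⊗[k] R}
    (hbr : IsDoubleBracket B br) {br' : hx.Corner →ₗ[k] hx.Corner →ₗ[k] hx.Corner ⊗[k] hx.Corner}
    (h : ∀ a b, TensorProduct.map (cornerVal hx) (cornerVal hx) (br' a b) =
      br (cornerVal (k := k) hx a) (cornerVal (k := k) hx b)) {S : Set hx.Corner}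
    (hS : ∀ a ∈ S, cornerVal (k := k) hx a ∈ B) : IsDoubleBracket (Algebra.adjoin k S) br' := by
  have hinj := map_cornerVal_injective (k := k) hx
  refine isDoubleBracket_adjoin (fun a b => eq_neg_of_add_eq_zero_left (hinj ?_)) (fun a b c => hinj ?_)
    (fun a ha b => hinj ?_)
  · have hc : ∀ w : hx.Corner ⊗[k] hx.Corner, TensorProduct.map (cornerVal (k := k) hx)
        (cornerVal hx) (TensorProduct.comm k _ _ w) = TensorProduct.comm k _ _
          (TensorProduct.map (cornerVal (k := k) hx) (cornerVal hx) w) := fun w => by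
      induction w using TensorProduct.induction_on with
      | zero => simp
      | add w w' h h' => simp only [map_add, h, h']
      | tmul b c => simp
    rw [map_add, hc, h, h, map_zero, hbr.antisymm, neg_add_cancel]
  · rw [h, map_add, map_cornerVal_mul_right, map_cornerVal_left_mul, h, h, cornerVal_mul]
    exact hbr.leibniz _ _ _
  · rw [h, map_zero]
    exact hbr.vanish_right _ (hS a ha) _

end Corner

/-! ### The fusion bracket -/

theorem IsDoubleBracket.mul_mul_right {k : Type*} [Field k] {R : Type*} [Ring R] [Algebra k R]
    {B : Subalgebra k R} {br : R →ₗ[k] R →ₗ[k] R ⊗[k] R} (h : IsDoubleBracket B br) {x y : R}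
    (hx : x ∈ B) (hy : y ∈ B) (a b : R) :
    br a (x * b * y) = (x ⊗ₜ[k] 1) * br a b * (1 ⊗ₜ[k] y) := by
  rw [h.leibniz, h.leibniz, h.vanish_right x hx, h.vanish_right y hy]
  simp

theorem IsDoubleBracket.mul_mul_left {k : Type*} [Field k] {R : Type*} [Ring R] [Algebra k R]
    {B : Subalgebra k R} {br : R →ₗ[k] R →ₗ[k] R ⊗[k] R} (h : IsDoubleBracket B br) {x y : R}
    (hx : x ∈ B) (hy : y ∈ B) (a b : R) :
    br (x * a * y) b = (1 ⊗ₜ[k] x) * br a b * (y ⊗ₜ[k] 1) := by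
  rw [h.leibniz_left, h.leibniz_left, h.vanish_left x hx, h.vanish_left y hy]
  simp

section Fusion

variable {k : Type*} [Field k] {A : Type*} [Ring A] [Algebra k A] {I : Type*} [Fintype I]
  {e : I → A} (he : CompleteOrthogonalIdempotents e) {p q : I} (hpq : p ≠ q)

variable (k) in
/-- The inclusion of the fusion algebra into the extension algebra. -/
abbrev fusionVal : FusionAlgebra k he hpq →ₗ[k] ExtAlgebra k he hpq :=
  cornerVal (eps_idem k he hpq)

theorem eps_fusionVal_eps (a : FusionAlgebra k he hpq) :
    eps k he hpq * fusionVal k he hpq a * eps k he hpq = fusionVal k he hpq a := by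
  rw [mul_cornerVal, cornerVal_mul_self]

theorem fusionVal_fusionIdem (s : {s : I // s ≠ q}) :
    fusionVal k he hpq (fusionIdem k he hpq s) = toExt k he hpq (e s) := by
  change eps k he hpq * toExt k he hpq (e s) * eps k he hpq = _
  rw [eps_mul_toExt he hpq s.2, toExt_mul_eps he hpq s.2]

/-- For `a = εaε`, linearity over `ε` puts the value of the derivation in `εĀ ⊗ Āε`. The outer cuts
then have no effect, and the inner ones are part of the definition of `extTraceGauge`. -/
theorem map_fusionVal_traceGauge (s : I) (a : FusionAlgebra k he hpq) :
    TensorProduct.map (fusionVal k he hpq) (fusionVal k he hpq) (traceGauge k he hpq s a) =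
      extTraceGauge k he hpq s (fusionVal k he hpq a) := by
  have h := (isDoubleDerivation_pushDer_gauge (k := k) he hpq s).mul_mul
    (eps_mem_extBase k he hpq) (eps_mem_extBase k he hpq) (fusionVal k he hpq a)
  rw [eps_fusionVal_eps] at h
  have hc : ∀ r, fusionVal k he hpq (cut k he hpq r) = eps k he hpq * r * eps k he hpq :=
    fun r => rfl
  have he1 := (eps_idem k he hpq).eq
  have he2 : ∀ y, eps k he hpq * (eps k he hpq * y) = eps k he hpq * y := fun y => by
    rw [← mul_assoc, he1]
  have he3 : ∀ y, eps k he hpq * (unit12 k he hpq * y) = unit12 k he hpq * y := fun y => by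
    rw [← mul_assoc, eps_mul_unit12]
  have key : ∀ w, TensorProduct.map (fusionVal k he hpq) (fusionVal k he hpq) ((TensorProduct.map
      (cut k he hpq) (cut k he hpq) + TensorProduct.map
        (cut k he hpq ∘ₗ LinearMap.mulRight k (unit21 k he hpq))
        (cut k he hpq ∘ₗ LinearMap.mulLeft k (unit12 k he hpq)))
          ((eps k he hpq ⊗ₜ[k] 1) * w * (1 ⊗ₜ[k] eps k he hpq))) =
      (innerMul (k := k) (eps k he hpq) (eps k he hpq)
        + innerMul (k := k) (unit21 k he hpq) (unit12 k he hpq))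
          ((eps k he hpq ⊗ₜ[k] 1) * w * (1 ⊗ₜ[k] eps k he hpq)) := fun w => by
    induction w using TensorProduct.induction_on with
    | zero => simp
    | add w w' h h' => simp only [mul_add, add_mul, map_add, h, h']
    | tmul b c =>
      simp only [Algebra.TensorProduct.tmul_mul_tmul, LinearMap.add_apply, map_add,
        TensorProduct.map_tmul, LinearMap.comp_apply, LinearMap.mulRight_apply,
        LinearMap.mulLeft_apply, innerMul_tmul, hc, one_mul, mul_one, mul_assoc, he1, he2, he3,
        unit21_mul_eps]
  have hkey := key (Amalgam.pushDer (baseMap_mem he hpq) (gauge_isDoubleDerivation (k := k) he s)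
    (fusionVal k he hpq a))
  rw [← h] at hkey
  exact hkey

variable {br : A →ₗ[k] A →ₗ[k] A ⊗[k] A} (hbr : IsDoubleBracket (idemSubalgebra k e) br)

/-- Linearity over `ε` in the second argument supplies the outer factors `ε`, and in the first
argument the inner ones, so the final projection acts trivially. -/
theorem map_fusionVal_inducedBracket (a b : FusionAlgebra k he hpq) :
    TensorProduct.map (fusionVal k he hpq) (fusionVal k he hpq) (inducedBracket he hpq hbr a b) =
      extBracket he hpq hbr (fusionVal k he hpq a) (fusionVal k he hpq b) := by
  have hε := eps_mem_extBase k he hpq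
  have h1 := (isDoubleBracket_extBracket he hpq hbr).mul_mul_right hε hε (fusionVal k he hpq a)
    (fusionVal k he hpq b)
  have h2 := (isDoubleBracket_extBracket he hpq hbr).mul_mul_left hε hε (fusionVal k he hpq a)
    (fusionVal k he hpq b)
  rw [eps_fusionVal_eps] at h1 h2
  have hc : ∀ w, TensorProduct.map (fusionVal k he hpq) (fusionVal k he hpq)
      (TensorProduct.map (cut k he hpq) (cut k he hpq) w) =
      (eps k he hpq ⊗ₜ[k] 1) * ((1 ⊗ₜ[k] eps k he hpq) * w * (eps k he hpq ⊗ₜ[k] 1)) *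
        (1 ⊗ₜ[k] eps k he hpq) := fun w => by
    induction w using TensorProduct.induction_on with
    | zero => simp
    | add w w' h h' => simp only [mul_add, add_mul, map_add, h, h']
    | tmul b c =>
      simp only [Algebra.TensorProduct.tmul_mul_tmul, TensorProduct.map_tmul, one_mul, mul_one,
        mul_assoc]
      simp only [← mul_assoc]
      rfl
  change TensorProduct.map (fusionVal k he hpq) (fusionVal k he hpq) (TensorProduct.map
    (cut k he hpq) (cut k he hpq) (extBracket he hpq hbr (fusionVal k he hpq a)
      (fusionVal k he hpq b))) = _
  rw [hc, ← h2, ← h1]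

theorem map_fusionVal_fusionBracket (a b : FusionAlgebra k he hpq) :
    TensorProduct.map (fusionVal k he hpq) (fusionVal k he hpq) (fusionBracket he hpq hbr a b) =
      extFusionBracket he hpq hbr (fusionVal k he hpq a) (fusionVal k he hpq b) := by
  rw [fusionBracket, bivectorBracket_smul, LinearMap.add_apply, LinearMap.add_apply, map_add,
    map_fusionVal_inducedBracket, LinearMap.smul_apply, LinearMap.smul_apply, map_smul,
    bivectorBracket_apply, map_sub, map_contract _ (cornerVal_mul _),
    map_contract _ (cornerVal_mul _), map_fusionVal_traceGauge, map_fusionVal_traceGauge,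
    map_fusionVal_traceGauge, map_fusionVal_traceGauge]
  rfl

theorem isDoubleBracket_fusionBracket :
    IsDoubleBracket (idemSubalgebra k (fusionIdem k he hpq)) (fusionBracket he hpq hbr) := by
  refine isDoubleBracket_corner _ (isDoubleBracket_extFusionBracket he hpq hbr)
    (map_fusionVal_fusionBracket he hpq hbr) ?_
  rintro _ ⟨s, rfl⟩
  rw [fusionVal_fusionIdem]
  exact toExt_mem_extBase _ _ _

variable (k) in
theorem completeOrthogonalIdempotents_fusionIdem [DecidableEq I] :
    CompleteOrthogonalIdempotents (fusionIdem k he hpq) where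
  idem s := cornerVal_injective (k := k) _ (by
    rw [cornerVal_mul, fusionVal_fusionIdem, ← map_mul, (he.idem s).eq])
  ortho s t hst := cornerVal_injective (k := k) _ (by
    rw [cornerVal_mul, fusionVal_fusionIdem, fusionVal_fusionIdem, ← map_mul,
      he.ortho fun h => hst (Subtype.ext h), map_zero, map_zero])
  complete := cornerVal_injective (k := k) _ (by
    rw [map_sum, cornerVal_one]
    simp only [fusionVal_fusionIdem]
    rw [eps, ← map_one (toExt k he hpq), ← he.complete, Fintype.sum_eq_add_sum_subtype_ne e q,
      map_add, map_sum, add_sub_cancel_left])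

/-- At `s = p` the additional summand `u ⊗ v` of `unitDer` is invisible on the corner: `a u = a ε u
= 0` and `v a = v ε a = 0`. -/
theorem map_fusionVal_gauge [DecidableEq I] (s : {s : I // s ≠ q}) (a : FusionAlgebra k he hpq) :
    TensorProduct.map (fusionVal k he hpq) (fusionVal k he hpq)
      (gauge k (fusionIdem k he hpq s) a) = extGauge k he hpq s (fusionVal k he hpq a) := by
  have h1 : TensorProduct.map (fusionVal k he hpq) (fusionVal k he hpq)
      (gauge k (fusionIdem k he hpq s) a) =
      gauge k (toExt k he hpq (e s)) (fusionVal k he hpq a) := by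
    rw [gauge_apply, map_sub, TensorProduct.map_tmul, TensorProduct.map_tmul, cornerVal_mul,
      cornerVal_mul, fusionVal_fusionIdem, gauge_apply]
  rw [h1, extGauge]
  split_ifs with h
  · have h2 : fusionVal k he hpq a * unit21 k he hpq = 0 := by
      rw [← cornerVal_mul_self, mul_assoc, eps_mul_unit21, mul_zero]
    have h3 : unit12 k he hpq * fusionVal k he hpq a = 0 := by
      rw [← mul_cornerVal, ← mul_assoc, unit12_mul_eps, zero_mul]
    rw [gauge_eq_innerDer, unitDer, innerDer_apply, innerDer_apply, h, unit12_mul_unit21]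
    simp [mul_add, add_mul, h2, h3]
  · rfl

theorem isQuasiPoisson_fusionBracket [CharZero k] [DecidableEq I] (hqp : IsQuasiPoisson e br) :
    IsQuasiPoisson (fusionIdem k he hpq) (fusionBracket he hpq hbr) := by
  intro a b c
  refine map_map_cornerVal_injective (k := k) _ ?_
  rw [map_tripleBracket (map_fusionVal_fusionBracket he hpq hbr),
    tripleBracket_extFusionBracket he hpq hbr hqp, map_smul, map_sum]
  refine congrArg _ (Finset.sum_congr rfl fun s _ => ?_)
  rw [quasiPoisson_term_eq_contract₃ ((completeOrthogonalIdempotents_fusionIdem k he hpq).idem s),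
    map_contract₃ _ (cornerVal_mul _), map_fusionVal_gauge, map_fusionVal_gauge,
    map_fusionVal_gauge]

end Fusion

/-! ### The moment map -/

section Moment

/-- Here `x = Φ_p`, `y = Φ_q` and `M = x v y u`. By Leibniz, `P(M, a)` has eight terms. Four are
among the eight on the right side; in the other four `x` and `y` lie in different tensor factors.
The bivector bracket of `M` and `a` equals those four unwanted terms minus the four missing ones, so
adding `-t` times it makes the exchange. The order of `x` and `y` in `M` is tied to the sign of the
bivector. -/
theorem IsUnitPair.bracket_moment {k : Type*} [Field k] {R : Type*} [Ring R] [Algebra k R]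
    {u v : R} (h : IsUnitPair u v) {B : Subalgebra k R} {P : R →ₗ[k] R →ₗ[k] R ⊗[k] R}
    (hP : IsDoubleBracket B P) {D₁ D₂ : R →ₗ[k] R ⊗[k] R} (h₁ : IsDoubleDerivation B D₁)
    (h₂ : IsDoubleDerivation B D₂) (hu : u ∈ B) (hv : v ∈ B) {x y a : R}
    (hx₁ : D₁ x = innerDer ((v * u) ⊗ₜ[k] (v * u)) x)
    (hy₁ : D₁ y = innerDer ((v * u) ⊗ₜ[k] (v * u)) y)
    (ha₁ : D₁ a = innerDer ((v * u) ⊗ₜ[k] (v * u)) a)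
    (hx₂ : D₂ x = innerDer (u ⊗ₜ[k] v) x) (hy₂ : D₂ y = innerDer (u ⊗ₜ[k] v) y)
    (ha₂ : D₂ a = innerDer (u ⊗ₜ[k] v) a) (hx : v * (u * x) = x) (hx' : x * (v * u) = x)
    (hy : u * (v * y) = y) (hy' : y * (u * v) = y) (t : k)
    (hPx : P x a = t • ((a * (v * u)) ⊗ₜ[k] x - (v * u) ⊗ₜ[k] (x * a) + (a * x) ⊗ₜ[k] (v * u)
      - x ⊗ₜ[k] (v * u * a)))
    (hPy : P y a = t • ((a * (u * v)) ⊗ₜ[k] y - (u * v) ⊗ₜ[k] (y * a) + (a * y) ⊗ₜ[k] (u * v)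
      - y ⊗ₜ[k] (u * v * a))) :
    (P + (-t) • bivectorBracket D₁ D₂) (x * (v * (y * u))) a =
      t • ((1 ⊗ₜ[k] (x * (v * (y * u)))) * unitDer k u v a
        + unitDer k u v a * ((x * (v * (y * u))) ⊗ₜ[k] 1)) := by
  have r1 : ∀ z, u * (u * z) = 0 := fun z => by rw [← mul_assoc, h.uu, zero_mul]
  have r2 : ∀ z, v * (v * z) = 0 := fun z => by rw [← mul_assoc, h.vv, zero_mul]
  have r3 : ∀ z, u * (v * (u * z)) = u * z := fun z => by
    rw [← mul_assoc v, ← mul_assoc u, h.uvu]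
  have r4 : ∀ z, v * (u * (v * z)) = v * z := fun z => by
    rw [← mul_assoc u, ← mul_assoc v, h.vuv]
  have x1 : ∀ z, x * (v * (u * z)) = x * z := fun z => by
    rw [← mul_assoc v, ← mul_assoc x, hx']
  have x2 : x * u = 0 := by rw [← hx', mul_assoc, mul_assoc, h.uu, mul_zero, mul_zero]
  have x3 : v * x = 0 := by rw [← hx, r2]
  have x4 : ∀ z, v * (x * z) = 0 := fun z => by rw [← mul_assoc, x3, zero_mul]
  have x5 : ∀ z, v * (u * (x * z)) = x * z := fun z => by
    rw [← mul_assoc u, ← mul_assoc v, hx]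
  have y1 : ∀ z, y * (u * (v * z)) = y * z := fun z => by
    rw [← mul_assoc u, ← mul_assoc y, hy']
  have y2 : y * v = 0 := by rw [← hy', mul_assoc, mul_assoc, h.vv, mul_zero, mul_zero]
  have y3 : u * y = 0 := by rw [← hy, r1]
  have y4 : ∀ z, u * (y * z) = 0 := fun z => by rw [← mul_assoc, y3, zero_mul]
  have y5 : ∀ z, u * (v * (y * z)) = y * z := fun z => by
    rw [← mul_assoc v, ← mul_assoc u, hy]
  have y6 : ∀ z, y * (v * z) = 0 := fun z => by rw [← mul_assoc, y2, zero_mul]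
  -- Since `u y = 0` and `y v = 0`, `D₁` sees only the factor `x`; since `v x = 0` and `x u = 0`,
  -- `D₂` sees only `y`.
  have e₁ : D₁ (x * (v * (y * u))) =
      x ⊗ₜ[k] (v * (y * u)) - (v * u) ⊗ₜ[k] (x * (v * (y * u))) := by
    simp only [h₁.leibniz, h₁.vanish u hu, h₁.vanish v hv, hx₁, hy₁, innerDer_apply,
      sub_mul, Algebra.TensorProduct.tmul_mul_tmul, mul_one, one_mul, mul_assoc,
      mul_zero, zero_mul, y4, y6, hx', x5, TensorProduct.tmul_zero, TensorProduct.zero_tmul,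
      sub_zero, add_zero, zero_add, r4]
  have e₂ : D₂ (x * (v * (y * u))) =
      (x * (v * (y * u))) ⊗ₜ[k] (v * u) - x ⊗ₜ[k] (v * (y * u)) := by
    simp only [h₂.leibniz, h₂.vanish u hu, h₂.vanish v hv, hx₂, hy₂, innerDer_apply,
      mul_sub, sub_mul, Algebra.TensorProduct.tmul_mul_tmul, mul_one, one_mul, mul_assoc,
      mul_zero, zero_mul, x2, x4, hx', TensorProduct.tmul_zero, TensorProduct.zero_tmul,
      sub_zero, add_zero, zero_add]
  have e₃ : P (x * (v * (y * u))) a = t • (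
      (a * (v * (y * u))) ⊗ₜ[k] x - (v * (y * u)) ⊗ₜ[k] (x * a)
        + (a * (x * (v * (y * u)))) ⊗ₜ[k] (v * u) - (x * (v * (y * u))) ⊗ₜ[k] (v * (u * a))
      + (a * u) ⊗ₜ[k] (x * (v * y)) - u ⊗ₜ[k] (x * (v * (y * a)))
        + (a * (y * u)) ⊗ₜ[k] (x * v) - (y * u) ⊗ₜ[k] (x * (v * a))) := by
    simp only [hP.leibniz_left, hP.vanish_left u hu, hP.vanish_left v hv, hPx, hPy, mul_add,
      mul_sub, sub_mul, add_mul, mul_smul_comm, smul_mul_assoc,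
      Algebra.TensorProduct.tmul_mul_tmul, mul_one, one_mul, mul_assoc, mul_zero, zero_mul,
      add_zero, zero_add, h.uvu, h.vuv, r4, smul_add, smul_sub]
    abel
  rw [LinearMap.add_apply, LinearMap.add_apply, LinearMap.smul_apply, LinearMap.smul_apply,
    bivectorBracket_apply, e₁, e₂, e₃, ha₁, ha₂, neg_smul, ← smul_neg, ← smul_add]
  congr 1
  simp only [unitDer, innerDer_apply, map_sub, LinearMap.sub_apply, contract_tmul, mul_add,
    add_mul, mul_sub, sub_mul, Algebra.TensorProduct.tmul_mul_tmul, mul_one, one_mul, mul_assoc,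
    h.uvu, h.vuv, hx', hy', r3, r4, x1, x5, y1, y5]
  abel

theorem isUnit_sum_of_corner {R : Type*} [Ring R] {I : Type*} [Fintype I] {e : I → R}
    (he : CompleteOrthogonalIdempotents e) {m n : I → R} (hm : ∀ s, e s * m s = m s)
    (hm' : ∀ s, m s * e s = m s) (hn : ∀ s, e s * n s = n s) (hn' : ∀ s, n s * e s = n s)
    (hmn : ∀ s, m s * n s = e s) (hnm : ∀ s, n s * m s = e s) : IsUnit (∑ s, m s) := by
  classical
  have key : ∀ f g : I → R, (∀ s, f s * e s = f s) → (∀ s, e s * g s = g s) →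
      (∀ s, f s * g s = e s) → (∑ s, f s) * ∑ s, g s = 1 := fun f g hf hg hfg => by
    rw [Finset.sum_mul_sum, ← he.complete]
    refine Finset.sum_congr rfl fun s _ => ?_
    rw [Finset.sum_eq_single s, hfg]
    · intro t _ hts
      rw [← hf s, ← hg t, mul_assoc, ← mul_assoc (e s), he.ortho hts.symm, zero_mul, mul_zero]
    · simp
  exact ⟨⟨_, _, key m n hm' hn hmn, key n m hn' hm hnm⟩, rfl⟩

theorem idem_mul_corner {R : Type*} [Ring R] {x : R} (hx : IsIdempotentElem x) (a : R) :
    x * (x * a * x) = x * a * x := by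
  rw [mul_assoc, ← mul_assoc, hx.eq]

theorem corner_mul_idem {R : Type*} [Ring R] {x : R} (hx : IsIdempotentElem x) (a : R) :
    x * a * x * x = x * a * x := by
  rw [mul_assoc, hx.eq]

variable {k : Type*} [Field k] {A : Type*} [Ring A] [Algebra k A] {I : Type*} [Fintype I]
  {e : I → A} (he : CompleteOrthogonalIdempotents e) {p q : I} (hpq : p ≠ q)

theorem left_mul_unit12 : toExt k he hpq (e p) * unit12 k he hpq = unit12 k he hpq := by
  rw [← unit12_mul_unit21, mul_assoc, (isUnitPair k he hpq).vuv]

theorem unit21_mul_left : unit21 k he hpq * toExt k he hpq (e p) = unit21 k he hpq := by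
  rw [← unit12_mul_unit21, (isUnitPair k he hpq).uvu]

theorem unit12_mul_right : unit12 k he hpq * toExt k he hpq (e q) = unit12 k he hpq := by
  rw [← unit21_mul_unit12, (isUnitPair k he hpq).vuv]

variable [DecidableEq I]

variable (k) in
/-- The components of the fused moment map, as elements of the extension algebra. -/
def extMoment (Φ : A) (s : {s : I // s ≠ q}) : ExtAlgebra k he hpq :=
  if s.1 = p then toExt k he hpq (e p * Φ * e p) *
    (unit12 k he hpq * (toExt k he hpq (e q * Φ * e q) * unit21 k he hpq))
  else toExt k he hpq (e s * Φ * e s)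

variable (k) in
/-- The components of the inverse of the fused moment map, for the inverse `Θ` of the moment
map. -/
def extMomentInv (Θ : A) (s : {s : I // s ≠ q}) : ExtAlgebra k he hpq :=
  if s.1 = p then unit12 k he hpq *
    (toExt k he hpq (e q * Θ * e q) * (unit21 k he hpq * toExt k he hpq (e p * Θ * e p)))
  else toExt k he hpq (e s * Θ * e s)

theorem idem_mul_extMoment (Φ : A) (s : {s : I // s ≠ q}) :
    toExt k he hpq (e s) * extMoment k he hpq Φ s = extMoment k he hpq Φ s := by
  unfold extMoment
  split_ifs with h
  · rw [h, ← mul_assoc, ← map_mul, idem_mul_corner (he.idem _)]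
  · rw [← map_mul, idem_mul_corner (he.idem _)]

theorem extMoment_mul_idem (Φ : A) (s : {s : I // s ≠ q}) :
    extMoment k he hpq Φ s * toExt k he hpq (e s) = extMoment k he hpq Φ s := by
  unfold extMoment
  split_ifs with h
  · rw [h, mul_assoc (toExt k he hpq _), mul_assoc (unit12 k he hpq), mul_assoc (toExt k he hpq _),
      unit21_mul_left]
  · rw [← map_mul, corner_mul_idem (he.idem _)]

theorem idem_mul_extMomentInv (Θ : A) (s : {s : I // s ≠ q}) :
    toExt k he hpq (e s) * extMomentInv k he hpq Θ s = extMomentInv k he hpq Θ s := by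
  unfold extMomentInv
  split_ifs with h
  · rw [h, ← mul_assoc, left_mul_unit12]
  · rw [← map_mul, idem_mul_corner (he.idem _)]

theorem extMomentInv_mul_idem (Θ : A) (s : {s : I // s ≠ q}) :
    extMomentInv k he hpq Θ s * toExt k he hpq (e s) = extMomentInv k he hpq Θ s := by
  unfold extMomentInv
  split_ifs with h
  · rw [h, mul_assoc (unit12 k he hpq), mul_assoc (toExt k he hpq _), mul_assoc (unit21 k he hpq),
      ← map_mul, corner_mul_idem (he.idem _)]
  · rw [← map_mul, corner_mul_idem (he.idem _)]

theorem extMoment_mul_extMomentInv {Φ Θ : A}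
    (h : ∀ s, e s * Φ * e s * (e s * Θ * e s) = e s) (s : {s : I // s ≠ q}) :
    extMoment k he hpq Φ s * extMomentInv k he hpq Θ s = toExt k he hpq (e s) := by
  unfold extMoment extMomentInv
  split_ifs with hs
  · have h1 : ∀ z, toExt k he hpq (e q * Φ * e q) * (unit21 k he hpq * (unit12 k he hpq *
        (toExt k he hpq (e q * Θ * e q) * z))) = toExt k he hpq (e q) * z := fun z => by
      rw [← mul_assoc (unit21 k he hpq), unit21_mul_unit12, ← mul_assoc (toExt k he hpq (e q)),
        ← map_mul, idem_mul_corner (he.idem _), ← mul_assoc, ← map_mul, h]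
    rw [mul_assoc (toExt k he hpq _), mul_assoc (unit12 k he hpq), mul_assoc (toExt k he hpq _), h1,
      ← mul_assoc (unit12 k he hpq), unit12_mul_right,
      ← mul_assoc (unit12 k he hpq), unit12_mul_unit21, ← mul_assoc, ← map_mul, ← map_mul,
      corner_mul_idem (he.idem _), h, hs]
  · rw [← map_mul, h]

theorem extMomentInv_mul_extMoment {Φ Θ : A}
    (h : ∀ s, e s * Θ * e s * (e s * Φ * e s) = e s) (s : {s : I // s ≠ q}) :
    extMomentInv k he hpq Θ s * extMoment k he hpq Φ s = toExt k he hpq (e s) := by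
  unfold extMoment extMomentInv
  split_ifs with hs
  · have h1 : ∀ z, toExt k he hpq (e p * Θ * e p) * (toExt k he hpq (e p * Φ * e p) * z) =
        toExt k he hpq (e p) * z := fun z => by
      rw [← mul_assoc, ← map_mul, h]
    rw [mul_assoc (unit12 k he hpq), mul_assoc (toExt k he hpq _), mul_assoc (unit21 k he hpq), h1,
      ← mul_assoc (unit21 k he hpq), unit21_mul_left,
      ← mul_assoc (unit21 k he hpq), unit21_mul_unit12, ← mul_assoc (toExt k he hpq (e q)),
      ← map_mul, idem_mul_corner (he.idem _), ← mul_assoc (toExt k he hpq _), ← map_mul, h, ← mul_assoc,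
      unit12_mul_right, unit12_mul_unit21, hs]
  · rw [← map_mul, h]

/-- For `s ≠ q` the twisted summand of `Tr(Φ_s)` vanishes because `e₁₂ e_s = 0`; for `s = q` the
untwisted one vanishes because `ε e_q = 0`, leaving `e₁₂ Φ_q e₂₁`. -/
theorem fusionVal_fusionMomentMap (Φ : A) :
    fusionVal k he hpq (fusionMomentMap k he hpq Φ) = ∑ s, extMoment k he hpq Φ s := by
  have htr : ∀ a, fusionVal k he hpq (trace k he hpq a) =
      eps k he hpq * toExt k he hpq a * eps k he hpq + eps k he hpq *
        (unit12 k he hpq * toExt k he hpq a * unit21 k he hpq) * eps k he hpq := fun a => rfl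
  have hne : ∀ s, s ≠ q → fusionVal k he hpq (trace k he hpq (e s * Φ * e s)) =
      toExt k he hpq (e s * Φ * e s) := fun s hs => by
    rw [htr]
    simp only [map_mul, ← mul_assoc, eps_mul_toExt he hpq hs]
    simp only [mul_assoc, toExt_mul_eps he hpq hs]
    rw [← mul_assoc (unit12 k he hpq), unit12_mul_toExt he hpq hs, zero_mul, mul_zero, add_zero]
  have hq : fusionVal k he hpq (trace k he hpq (e q * Φ * e q)) =
      unit12 k he hpq * (toExt k he hpq (e q * Φ * e q) * unit21 k he hpq) := by
    have h0 : eps k he hpq * toExt k he hpq (e q) = 0 := by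
      rw [← unit21_mul_unit12, ← mul_assoc, eps_mul_unit21, zero_mul]
    rw [htr]
    simp only [map_mul, ← mul_assoc, h0, eps_mul_unit12, zero_mul, zero_add]
    simp only [mul_assoc, unit21_mul_eps]
  rw [fusionMomentMap, map_add, cornerVal_mul, cornerVal_mul, cornerVal_mul,
    fusionVal_fusionIdem, hne p hpq, hq, map_sum,
    ← Finset.add_sum_erase _ _ (Finset.mem_univ (⟨p, hpq⟩ : {s : I // s ≠ q})),
    ← Finset.add_sum_erase _ (fun s => extMoment k he hpq Φ s)
      (Finset.mem_univ (⟨p, hpq⟩ : {s : I // s ≠ q})), if_pos rfl, map_zero, zero_add]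
  congr 1
  · have h1 := idem_mul_extMoment (k := k) he hpq Φ ⟨p, hpq⟩
    have h2 := extMoment_mul_idem (k := k) he hpq Φ ⟨p, hpq⟩
    rw [← h2, ← h1, extMoment, if_pos rfl, ← mul_assoc (toExt k he hpq _) (toExt k he hpq _)]
  · refine Finset.sum_congr rfl fun s hs => ?_
    have hsp : s.1 ≠ p := fun h => Finset.ne_of_mem_erase hs (Subtype.ext h)
    rw [if_neg hsp, extMoment, if_neg hsp, cornerVal_mul, cornerVal_mul, fusionVal_fusionIdem,
      hne s s.2, ← map_mul, ← map_mul, idem_mul_corner (he.idem _), corner_mul_idem (he.idem _)]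

end Moment

/-! ### The moment map identity and invertibility for the fused element -/

section FusionMoment

/-- A diagonal `Φ` commutes with every `e_s`, so the corners of its inverse are inverse to its
corners; diagonality of `Θ` is not needed. -/
theorem corner_mul_corner_inv {R : Type*} [Ring R] {I : Type*} [Fintype I] {e : I → R}
    (he : CompleteOrthogonalIdempotents e) {Φ Θ : R} (hΦ : Φ = ∑ s, e s * Φ * e s)
    (h1 : Φ * Θ = 1) (h2 : Θ * Φ = 1) (s : I) :
    e s * Φ * e s * (e s * Θ * e s) = e s ∧ e s * Θ * e s * (e s * Φ * e s) = e s := by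
  classical
  have hl : e s * Φ = e s * Φ * e s := by
    conv_lhs => rw [hΦ, Finset.mul_sum]
    rw [Finset.sum_eq_single s]
    · exact idem_mul_corner (he.idem s) Φ
    · intro t _ hts
      rw [mul_assoc (e t), ← mul_assoc, he.ortho hts.symm, zero_mul]
    · simp
  have hr : Φ * e s = e s * Φ * e s := by
    conv_lhs => rw [hΦ, Finset.sum_mul]
    rw [Finset.sum_eq_single s]
    · exact corner_mul_idem (he.idem s) Φ
    · intro t _ hts
      rw [mul_assoc, he.ortho hts, mul_zero]
    · simp
  constructor
  · rw [mul_assoc (e s) Θ, ← mul_assoc _ (e s), corner_mul_idem (he.idem s), ← hl, mul_assoc,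
      ← mul_assoc Φ, h1, one_mul, (he.idem s).eq]
  · rw [mul_assoc _ (e s), idem_mul_corner (he.idem s), ← hr, mul_assoc, ← mul_assoc Θ, h2,
      one_mul, (he.idem s).eq]

variable {k : Type*} [Field k] {A : Type*} [Ring A] [Algebra k A] {I : Type*} [Fintype I]
  {e : I → A} (he : CompleteOrthogonalIdempotents e) {p q : I} (hpq : p ≠ q)
  {br : A →ₗ[k] A →ₗ[k] A ⊗[k] A} (hbr : IsDoubleBracket (idemSubalgebra k e) br)

theorem extBracket_moment {Φ : A} (hm : IsMomentMap e br Φ) (s : I) (a : A) :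
    extBracket he hpq hbr (toExt k he hpq (e s * Φ * e s)) (toExt k he hpq a) = (1 / 2 : k) • (
      (toExt k he hpq a * toExt k he hpq (e s)) ⊗ₜ[k] toExt k he hpq (e s * Φ * e s)
    - toExt k he hpq (e s) ⊗ₜ[k] (toExt k he hpq (e s * Φ * e s) * toExt k he hpq a)
    + (toExt k he hpq a * toExt k he hpq (e s * Φ * e s)) ⊗ₜ[k] toExt k he hpq (e s)
    - toExt k he hpq (e s * Φ * e s) ⊗ₜ[k] (toExt k he hpq (e s) * toExt k he hpq a)) := by
  rw [← extBracket_toExt, hm.moment s a, map_smul]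
  simp only [map_add, map_sub, TensorProduct.map_tmul, AlgHom.toLinearMap_apply, map_mul]

theorem fusionVal_cut {s : I} (hs : s ≠ q) {x : ExtAlgebra k he hpq}
    (h1 : toExt k he hpq (e s) * x = x) (h2 : x * toExt k he hpq (e s) = x) :
    fusionVal k he hpq (cut k he hpq x) = x := by
  change eps k he hpq * x * eps k he hpq = x
  rw [← h1, ← mul_assoc, eps_mul_toExt he hpq hs, h1, ← h2, mul_assoc, toExt_mul_eps he hpq hs]

variable [DecidableEq I]

theorem extFusionBracket_extMoment_toExt {Φ : A} (hm : IsMomentMap e br Φ) (s : {s : I // s ≠ q})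
    (a : A) : extFusionBracket he hpq hbr (extMoment k he hpq Φ s) (toExt k he hpq a) =
      (1 / 2 : k) • ((1 ⊗ₜ[k] extMoment k he hpq Φ s) * extGauge k he hpq s (toExt k he hpq a)
        + extGauge k he hpq s (toExt k he hpq a) * (extMoment k he hpq Φ s ⊗ₜ[k] 1)) := by
  have hP := extBracket_moment he hpq hbr hm
  by_cases h : s.1 = p
  · rw [extMoment, extGauge, if_pos h, if_pos h]
    refine (isUnitPair k he hpq).bracket_moment (isDoubleBracket_extBracket he hpq hbr)
      (isDoubleDerivation_extTraceGauge he hpq p) (isDoubleDerivation_extTraceGauge he hpq q)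
      (unit21_mem_extBase k he hpq) (unit12_mem_extBase k he hpq)
      (extTraceGauge_left he hpq _) (extTraceGauge_left he hpq _) (extTraceGauge_left he hpq _)
      (extTraceGauge_right he hpq _) (extTraceGauge_right he hpq _) (extTraceGauge_right he hpq _)
      ?_ ?_ ?_ ?_ (1 / 2) ?_ ?_
    · rw [← mul_assoc, unit12_mul_unit21, ← map_mul, idem_mul_corner (he.idem p)]
    · rw [unit12_mul_unit21, ← map_mul, corner_mul_idem (he.idem p)]
    · rw [← mul_assoc, unit21_mul_unit12, ← map_mul, idem_mul_corner (he.idem q)]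
    · rw [unit21_mul_unit12, ← map_mul, corner_mul_idem (he.idem q)]
    · rw [hP, unit12_mul_unit21]
    · rw [hP, unit21_mul_unit12]
  · rw [extMoment, extGauge, if_neg h, if_neg h]
    set x := toExt k he hpq (e s * Φ * e s) with hx
    have hx1 : toExt k he hpq (e s) * x = x := by rw [hx, ← map_mul, idem_mul_corner (he.idem s)]
    have hx2 : x * toExt k he hpq (e s) = x := by rw [hx, ← map_mul, corner_mul_idem (he.idem s)]
    -- For `s ≠ p, q` the element `x = e_s x e_s` is orthogonal to the matrix units, so both traces
    -- kill it, the fusion term drops out, and the moment identity of `A` remains.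
    have h1 : extTraceGauge k he hpq p x = 0 := by
      rw [hx, extTraceGauge_left, ← hx, innerDer_apply, ← hx1, ← hx2]
      simp only [Algebra.TensorProduct.tmul_mul_tmul, one_mul, mul_one, mul_assoc,
        ← mul_assoc (toExt k he hpq _) (unit12 k he hpq), toExt_mul_unit12 he hpq h,
        ← mul_assoc (unit21 k he hpq) (toExt k he hpq _), unit21_mul_toExt he hpq h, zero_mul,
        mul_zero, TensorProduct.zero_tmul, TensorProduct.tmul_zero, sub_zero]
    have h2 : extTraceGauge k he hpq q x = 0 := by
      rw [hx, extTraceGauge_right, ← hx, innerDer_apply, ← hx1, ← hx2]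
      simp only [Algebra.TensorProduct.tmul_mul_tmul, one_mul, mul_one, mul_assoc,
        toExt_mul_unit21 he hpq s.2, ← mul_assoc (unit12 k he hpq) (toExt k he hpq _),
        unit12_mul_toExt he hpq s.2, zero_mul,
        mul_zero, TensorProduct.zero_tmul, TensorProduct.tmul_zero, sub_zero]
    rw [extFusionBracket, LinearMap.add_apply, LinearMap.add_apply, LinearMap.smul_apply,
      LinearMap.smul_apply, bivectorBracket_apply, h1, h2, hP, ← hx, gauge_apply]
    simp only [map_zero, LinearMap.zero_apply, sub_zero, smul_zero, add_zero, mul_sub,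
      sub_mul, Algebra.TensorProduct.tmul_mul_tmul, one_mul, mul_one, hx1, hx2, mul_assoc,
      ← mul_assoc x (toExt k he hpq (e s))]
    congr 1

/-- The moment map identity on the extension algebra. -/
theorem extFusionBracket_extMoment {Φ : A} (hm : IsMomentMap e br Φ) (s : {s : I // s ≠ q})
    (a : ExtAlgebra k he hpq) : extFusionBracket he hpq hbr (extMoment k he hpq Φ s) a =
      (1 / 2 : k) • ((1 ⊗ₜ[k] extMoment k he hpq Φ s) * extGauge k he hpq s a
        + extGauge k he hpq s a * (extMoment k he hpq Φ s ⊗ₜ[k] 1)) := by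
  set M := extMoment k he hpq Φ s with hM
  have hQ := isDoubleBracket_extFusionBracket he hpq hbr
  have hG := isDoubleDerivation_extGauge (k := k) he hpq s
  have happ : ∀ a, ((1 / 2 : k) • ((innerMul (k := k) 1 M + innerMul (k := k) M 1) ∘ₗ
      extGauge k he hpq s)) a = (1 / 2 : k) • ((1 ⊗ₜ[k] M) * extGauge k he hpq s a
        + extGauge k he hpq s a * (M ⊗ₜ[k] 1)) := fun a => by
    simp only [LinearMap.smul_apply, LinearMap.comp_apply, LinearMap.add_apply, innerMul_eq,
      ← Algebra.TensorProduct.one_def, one_mul, mul_one]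
  rw [← happ]
  -- With the moment component fixed, both sides are outer derivations in `a` that vanish on the
  -- matrix summand, so agreement on `A` is enough.
  refine LinearMap.congr_fun (Amalgam.derivation_ext Algebra.TensorProduct.includeLeft
    Algebra.TensorProduct.includeRight (fun x y => ?_) (fun x y => ?_) (fun a => ?_)
    (fun m => ?_)) a
  · exact (hQ.leibniz _ x y).trans (add_comm _ _)
  · simp only [LinearMap.smul_apply, LinearMap.comp_apply, LinearMap.add_apply, hG.leibniz,
      innerMul_leibniz, Algebra.TensorProduct.includeLeft_apply,
      Algebra.TensorProduct.includeRight_apply, smul_add, mul_add, add_mul, mul_smul_comm,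
      smul_mul_assoc]
    abel
  · rw [happ]
    exact extFusionBracket_extMoment_toExt he hpq hbr hm s a
  · have hmem := inr_mem_extBase he hpq m
    rw [hQ.vanish_right _ hmem, LinearMap.smul_apply, LinearMap.comp_apply, hG.vanish _ hmem,
      map_zero, smul_zero]

theorem fusionVal_cut_extMoment (Φ : A) (s : {s : I // s ≠ q}) :
    fusionVal k he hpq (cut k he hpq (extMoment k he hpq Φ s)) = extMoment k he hpq Φ s :=
  fusionVal_cut he hpq s.2 (idem_mul_extMoment he hpq Φ s) (extMoment_mul_idem he hpq Φ s)

theorem fusionMomentMap_eq_sum (Φ : A) :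
    fusionMomentMap k he hpq Φ = ∑ s, cut k he hpq (extMoment k he hpq Φ s) :=
  cornerVal_injective (k := k) _ (by
    rw [fusionVal_fusionMomentMap, map_sum]
    simp only [fusionVal_cut_extMoment])

theorem idem_mul_fusionMomentMap_mul_idem (Φ : A) (s : {s : I // s ≠ q}) :
    fusionIdem k he hpq s * fusionMomentMap k he hpq Φ * fusionIdem k he hpq s =
      cut k he hpq (extMoment k he hpq Φ s) := by
  refine cornerVal_injective (k := k) _ ?_
  rw [cornerVal_mul, cornerVal_mul, fusionVal_fusionIdem, fusionVal_fusionMomentMap,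
    fusionVal_cut_extMoment, Finset.mul_sum, Finset.sum_mul, Finset.sum_eq_single s,
    idem_mul_extMoment, extMoment_mul_idem]
  · intro t _ hts
    rw [← idem_mul_extMoment, ← mul_assoc, ← map_mul, he.ortho fun h => hts (Subtype.ext h.symm),
      map_zero, zero_mul, zero_mul]
  · simp

theorem isMomentMap_fusionMomentMap {Φ : A} (hm : IsMomentMap e br Φ) :
    IsMomentMap (fusionIdem k he hpq) (fusionBracket he hpq hbr)
      (fusionMomentMap k he hpq Φ) where
  isUnit := by
    obtain ⟨⟨Φ', Θ, h1, h2⟩, h3⟩ := hm.isUnit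
    obtain rfl : Φ' = Φ := h3
    have hΘ := corner_mul_corner_inv he hm.diagonal h1 h2
    have hinj := cornerVal_injective (k := k) (eps_idem k he hpq)
    have hn : ∀ s, fusionVal k he hpq (cut k he hpq (extMomentInv k he hpq Θ s)) =
        extMomentInv k he hpq Θ s := fun s =>
      fusionVal_cut he hpq s.2 (idem_mul_extMomentInv he hpq Θ s) (extMomentInv_mul_idem he hpq Θ s)
    rw [fusionMomentMap_eq_sum]
    refine isUnit_sum_of_corner (completeOrthogonalIdempotents_fusionIdem k he hpq)
      (n := fun s => cut k he hpq (extMomentInv k he hpq Θ s)) (fun s => hinj ?_)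
      (fun s => hinj ?_) (fun s => hinj ?_) (fun s => hinj ?_) (fun s => hinj ?_)
      (fun s => hinj ?_)
    · rw [cornerVal_mul, fusionVal_fusionIdem, fusionVal_cut_extMoment, idem_mul_extMoment]
    · rw [cornerVal_mul, fusionVal_fusionIdem, fusionVal_cut_extMoment, extMoment_mul_idem]
    · rw [cornerVal_mul, fusionVal_fusionIdem, hn, idem_mul_extMomentInv]
    · rw [cornerVal_mul, fusionVal_fusionIdem, hn, extMomentInv_mul_idem]
    · rw [cornerVal_mul, fusionVal_fusionIdem, hn, fusionVal_cut_extMoment,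
        extMoment_mul_extMomentInv he hpq fun s => (hΘ s).1]
    · rw [cornerVal_mul, fusionVal_fusionIdem, hn, fusionVal_cut_extMoment,
        extMomentInv_mul_extMoment he hpq fun s => (hΘ s).2]
  diagonal := by
    simp only [idem_mul_fusionMomentMap_mul_idem]
    exact fusionMomentMap_eq_sum he hpq Φ
  moment s a := by
    have h1 := idem_mul_extMoment (k := k) he hpq Φ s
    have h2 := extMoment_mul_idem (k := k) he hpq Φ s
    refine map_cornerVal_injective (k := k) _ ?_
    rw [map_fusionVal_fusionBracket, idem_mul_fusionMomentMap_mul_idem, fusionVal_cut_extMoment,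
      extFusionBracket_extMoment he hpq hbr hm, ← map_fusionVal_gauge, map_smul, gauge_apply]
    simp only [map_add, map_sub, TensorProduct.map_tmul, cornerVal_mul, fusionVal_fusionIdem,
      fusionVal_cut_extMoment, mul_sub, sub_mul, Algebra.TensorProduct.tmul_mul_tmul, one_mul,
      mul_one, mul_assoc, h1, h2, ← mul_assoc (extMoment k he hpq Φ s) (toExt k he hpq (e s))]
    congr 1

end FusionMoment

/-! ### Finite generation -/

section FiniteType

variable {k : Type*} [Field k] {A : Type*} [Ring A] [Algebra k A] {I : Type*} [Fintype I]
  {e : I → A} (he : CompleteOrthogonalIdempotents e) {p q : I} (hpq : p ≠ q)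

/-- Insert `1 = ε + e₂₁ e₁₂` between `x` and `y`, then use `e₂₁ ε = e₂₁`. It is a 2 × 2 matrix
product whose entries lie in the corner. -/
theorem cut_mul (x y : ExtAlgebra k he hpq) : cut k he hpq (x * y) =
    cut k he hpq x * cut k he hpq y
      + cut k he hpq (x * unit21 k he hpq) * cut k he hpq (unit12 k he hpq * y) := by
  refine cornerVal_injective (k := k) _ ?_
  rw [map_add, cornerVal_mul, cornerVal_mul]
  change eps k he hpq * (x * y) * eps k he hpq =
    eps k he hpq * x * eps k he hpq * (eps k he hpq * y * eps k he hpq)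
      + eps k he hpq * (x * unit21 k he hpq) * eps k he hpq *
        (eps k he hpq * (unit12 k he hpq * y) * eps k he hpq)
  have h1 : ∀ z, eps k he hpq * (eps k he hpq * z) = eps k he hpq * z := fun z => by
    rw [← mul_assoc, (eps_idem k he hpq).eq]
  have h2 : ∀ z, unit21 k he hpq * (eps k he hpq * z) = unit21 k he hpq * z := fun z => by
    rw [← mul_assoc, unit21_mul_eps]
  have h3 : ∀ z, eps k he hpq * z + unit21 k he hpq * (unit12 k he hpq * z) = z := fun z => by
    rw [← mul_assoc, unit21_mul_unit12, eps, ← add_mul, sub_add_cancel, one_mul]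
  simp only [mul_assoc, h1, h2]
  rw [← mul_add, ← mul_add, h3]

theorem finiteType_fusionAlgebra (hA : Algebra.FiniteType k A) :
    Algebra.FiniteType k (FusionAlgebra k he hpq) := by
  obtain ⟨S, hS⟩ := hA.out
  obtain ⟨T, hT⟩ :=
    (inferInstance : Algebra.FiniteType k (Matrix (Fin 2) (Fin 2) k × k)).out
  -- The element `1` is included for the sake of the scalars: its twisted cut `e₁₂ · 1 · e₂₁ = e_p`
  -- has to be among the generators.
  set G : Set (ExtAlgebra k he hpq) := insert 1 (toExt k he hpq '' S ∪
    Amalgam.inr (baseMap k he hpq) (matMap k) '' T) with hG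
  have hGfin : G.Finite := ((S.finite_toSet.image _).union (T.finite_toSet.image _)).insert 1
  set V : Set (FusionAlgebra k he hpq) := cut k he hpq '' G
    ∪ (fun x => cut k he hpq (unit12 k he hpq * x)) '' G
    ∪ (fun x => cut k he hpq (x * unit21 k he hpq)) '' G
    ∪ (fun x => cut k he hpq (unit12 k he hpq * x * unit21 k he hpq)) '' G with hV
  have hVfin : V.Finite :=
    (((hGfin.image _).union (hGfin.image _)).union (hGfin.image _)).union (hGfin.image _)
  -- The four conditions concern the four matrix entries of `x`. The first alone is not stable under
  -- products, since `cut_mul` brings in the other entries; all four together are.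
  let Good (x : ExtAlgebra k he hpq) : Prop := cut k he hpq x ∈ Algebra.adjoin k V ∧
    cut k he hpq (unit12 k he hpq * x) ∈ Algebra.adjoin k V ∧
    cut k he hpq (x * unit21 k he hpq) ∈ Algebra.adjoin k V ∧
    cut k he hpq (unit12 k he hpq * x * unit21 k he hpq) ∈ Algebra.adjoin k V
  have hgen : ∀ x ∈ G, Good x := fun x hx =>
    ⟨Algebra.subset_adjoin (Or.inl (Or.inl (Or.inl ⟨x, hx, rfl⟩))),
      Algebra.subset_adjoin (Or.inl (Or.inl (Or.inr ⟨x, hx, rfl⟩))),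
      Algebra.subset_adjoin (Or.inl (Or.inr ⟨x, hx, rfl⟩)),
      Algebra.subset_adjoin (Or.inr ⟨x, hx, rfl⟩)⟩
  have hadd : ∀ x y, Good x → Good y → Good (x + y) := by
    rintro x y ⟨h1, h2, h3, h4⟩ ⟨h1', h2', h3', h4'⟩
    refine ⟨?_, ?_, ?_, ?_⟩ <;> simp only [mul_add, add_mul, map_add]
    exacts [add_mem h1 h1', add_mem h2 h2', add_mem h3 h3', add_mem h4 h4']
  have hmul : ∀ x y, Good x → Good y → Good (x * y) := by
    rintro x y ⟨h1, h2, h3, h4⟩ ⟨h1', h2', h3', h4'⟩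
    refine ⟨?_, ?_, ?_, ?_⟩
    · rw [cut_mul]
      exact add_mem (mul_mem h1 h1') (mul_mem h3 h2')
    · rw [← mul_assoc, cut_mul]
      exact add_mem (mul_mem h2 h1') (mul_mem h4 h2')
    · rw [mul_assoc, cut_mul, ← mul_assoc]
      exact add_mem (mul_mem h1 h3') (mul_mem h3 h4')
    · rw [← mul_assoc, mul_assoc _ y, cut_mul, ← mul_assoc _ y]
      exact add_mem (mul_mem h2 h3') (mul_mem h4 h4')
  have hsmul : ∀ (r : k), Good (algebraMap k _ r) := fun r => by
    obtain ⟨h1, h2, h3, h4⟩ := hgen 1 (Set.mem_insert _ _)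
    rw [Algebra.algebraMap_eq_smul_one]
    refine ⟨?_, ?_, ?_, ?_⟩ <;> simp only [mul_smul_comm, smul_mul_assoc, map_smul]
    exacts [Subalgebra.smul_mem _ h1 r, Subalgebra.smul_mem _ h2 r, Subalgebra.smul_mem _ h3 r,
      Subalgebra.smul_mem _ h4 r]
  have hgood : ∀ x, Good x := by
    refine Amalgam.induction (fun a => ?_) (fun m => ?_) hadd hmul
    · have ha : a ∈ Algebra.adjoin k (S : Set A) := hS ▸ Algebra.mem_top
      induction ha using Algebra.adjoin_induction with
      | mem a ha => exact hgen _ (Or.inr (Or.inl ⟨a, ha, rfl⟩))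
      | algebraMap r => rw [AlgHom.commutes]; exact hsmul r
      | add a b _ _ ha hb => rw [map_add]; exact hadd _ _ ha hb
      | mul a b _ _ ha hb => rw [map_mul]; exact hmul _ _ ha hb
    · have hm : m ∈ Algebra.adjoin k (T : Set (Matrix (Fin 2) (Fin 2) k × k)) :=
        hT ▸ Algebra.mem_top
      induction hm using Algebra.adjoin_induction with
      | mem a ha => exact hgen _ (Or.inr (Or.inr ⟨a, ha, rfl⟩))
      | algebraMap r => rw [AlgHom.commutes]; exact hsmul r
      | add a b _ _ ha hb => rw [map_add]; exact hadd _ _ ha hb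
      | mul a b _ _ ha hb => rw [map_mul]; exact hmul _ _ ha hb
  refine ⟨⟨hVfin.toFinset, ?_⟩⟩
  rw [Set.Finite.coe_toFinset, eq_top_iff]
  intro x _
  have hx := (hgood (fusionVal k he hpq x)).1
  rwa [cut, cornerProj_cornerVal] at hx

end FiniteType

end

end DoubleBracket

theorem mainTheorem2 {k : Type*} [Field k] [CharZero k] {A : Type*} [Ring A] [Algebra k A]
    {I : Type*} [Fintype I] [DecidableEq I] {e : I → A} {br : A →ₗ[k] A →ₗ[k] A ⊗[k] A} {Φ : A}
    (h : DoubleBracket.IsQuasiHamiltonian e br Φ) {p q : I} (hpq : p ≠ q) :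
    DoubleBracket.IsQuasiHamiltonian (DoubleBracket.fusionIdem k h.idem hpq)
        (DoubleBracket.fusionBracket h.idem hpq h.bracket)
        (DoubleBracket.fusionMomentMap k h.idem hpq Φ) ∧
      (Algebra.FiniteType k A →
        Algebra.FiniteType k (DoubleBracket.FusionAlgebra k h.idem hpq)) :=
  ⟨{ idem := DoubleBracket.completeOrthogonalIdempotents_fusionIdem k h.idem hpq
     bracket := DoubleBracket.isDoubleBracket_fusionBracket h.idem hpq h.bracket
     quasiPoisson :=
      DoubleBracket.isQuasiPoisson_fusionBracket h.idem hpq h.bracket h.quasiPoisson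
     momentMap :=
      DoubleBracket.isMomentMap_fusionMomentMap h.idem hpq h.bracket h.momentMap },
    DoubleBracket.finiteType_fusionAlgebra h.idem hpq⟩
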